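/- Let $G$ be a finite group. A set $\delta$ of proper subgroups of $G$ is called a covering of $G$ if $G=\bigcup_{L\in\delta}L$ and no member of $\delta$ is contained in a different member of $\delta$. The group $G$ is called $(\ast\ast)$-coverable if there are two proper subgroups $H,K<G$ such that $\delta=\{H^g,K^g : g\in G\}$, where $H^g=g^{-1}Hg$, is a covering of $G$. (For a finite group the condition on inclusions follows automatically once $H,K$ are proper and $G=\bigcup_{g\in G}H^g\cup\bigcup_{g\in G}K^g$.) **Theorem.** For every natural number $n$, the alternating group $A_n$ is $(\ast\ast)$-coverable if and only if $4\le n\le 8$. -/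

import Mathlib

/-- A set `δ` of subgroups of `G` is a covering of `G` if its members are proper subgroups, `G` is
their set-theoretical union, and there are no inclusions between distinct members. -/
structure IsGroupCovering {G : Type*} [Group G] (δ : Set (Subgroup G)) : Prop where
  proper : ∀ L ∈ δ, L ≠ ⊤
  union_eq : (⋃ L ∈ δ, (L : Set G)) = Set.univ
  not_le : ∀ L ∈ δ, ∀ M ∈ δ, L ≠ M → ¬ L ≤ M

/-- The set of all `G`-conjugates `g H g⁻¹` of the subgroup `H`. -/
def conjugateSubgroups {G : Type*} [Group G] (H : Subgroup G) : Set (Subgroup G) :=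
  {L | ∃ g : G, L = H.map (MulAut.conj g).toMonoidHom}

/-- `G` is (∗∗)-coverable: there are proper subgroups `H`, `K` of `G` such that the `G`-conjugates
of `H` and the `G`-conjugates of `K` together form a covering of `G`. -/
def IsStarStarCoverable (G : Type*) [Group G] : Prop :=
  ∃ H K : Subgroup G, H ≠ ⊤ ∧ K ≠ ⊤ ∧
    IsGroupCovering (conjugateSubgroups H ∪ conjugateSubgroups K)

open Equiv.Perm MulAction
open scoped Pointwise

/-! A covering by the conjugates of `H` and `K` means that every even permutation is conjugate, by
an even permutation, to an element of `H` or `K`. For n ≥ 9 this is refuted almost entirely by cycle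
types: each partition of n belonging to an even permutation must occur in one of the two subgroups.

A subgroup that does not contain A_n is intransitive, imprimitive or primitive, and each alternative
excludes many types (`intransitive_or_imprimitive_or_primitive`). An orbit of size k forces every
type to have parts with sum k. If blocks have size d and some power of an element is a q-cycle with
q ≥ d, then d divides n - q. A primitive subgroup has, by Jordan's theorem
(`alternatingGroup_le_of_isPreprimitive_of_prime_cycle_mem`), no element with a power that is a
cycle of prime length with at least three fixed points. Testing a few types with small parts, such
as {3, 1, n - 4} or {3, n - 3}, against these conditions leaves only n = 9, 10, 12, with one
subgroup satisfying the condition of the primitive case and the other intransitive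
(`odd_degree_exception`, `even_degree_exception_of_pair`).

In degrees 10 and 12 the first subgroup is forced to contain so many types that a commutator of two
of its elements is a three-cycle, which is excluded. In degree 9 it has to contain all the
nine-cycles up to even conjugation. These form two classes of A_9, and a Sylow argument shows that a
subgroup of A_9 without three-cycles cannot meet both.

For 4 ≤ n ≤ 8, `H` is the automorphism group of a small geometry and `K` the stabilizer of a set of
one, two or three points; membership in both is decidable. For n < 4 the group has order 1 or 3, so
its proper subgroups are trivial. -/

theorem exists_conj_mem_zpowers_of_not_sq_dvd_card {T : Type*} [Group T] [Finite T] {p : ℕ}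
    (hp : p.Prime) (hT : ¬ p ^ 2 ∣ Nat.card T) {c c' : T} (hc : orderOf c = p)
    (hc' : orderOf c' = p) : ∃ t : T, t * c' * t⁻¹ ∈ Subgroup.zpowers c := by
  have : Fact p.Prime := ⟨hp⟩
  have hfac : (Nat.card T).factorization p = 1 := by
    have h0 : Nat.card T ≠ 0 := Nat.card_pos.ne'
    have h1 : 1 ≤ (Nat.card T).factorization p :=
      (hp.dvd_iff_one_le_factorization h0).1 (hc ▸ orderOf_dvd_natCard c)
    have h2 : ¬ 2 ≤ (Nat.card T).factorization p := fun h =>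
      hT ((hp.pow_dvd_iff_le_factorization h0).2 h)
    omega
  -- The exact power of `p` dividing the order of `T` is `p` itself, so both cyclic groups are Sylow
  -- subgroups and hence conjugate.
  let P : Sylow p T := Sylow.ofCard (Subgroup.zpowers c) (by rw [hfac, pow_one, Nat.card_zpowers, hc])
  let P' : Sylow p T :=
    Sylow.ofCard (Subgroup.zpowers c') (by rw [hfac, pow_one, Nat.card_zpowers, hc'])
  obtain ⟨t, ht⟩ := MulAction.exists_smul_eq T P' P
  refine ⟨t, ?_⟩
  have h1 : t * c' * t⁻¹ ∈ (t • P' : Sylow p T) := by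
    rw [Sylow.smul_def]
    have : c' ∈ P'.1 := Subgroup.mem_zpowers c'
    simpa using! Subgroup.smul_mem_pointwise_smul c' (MulAut.conj t) P'.1 this
  rw [ht] at h1
  exact h1

/-! ### Jordan's theorem on primitive groups containing a cycle of prime length -/

section Jordan

variable {α : Type*} {G : Subgroup (Equiv.Perm α)}

theorem exists_mem_eqOn_of_isMultiplyPretransitive {k : ℕ} (hG : IsMultiplyPretransitive G α k)
    {s : Finset α} (hs : s.card = k) (π : Equiv.Perm α) : ∃ g ∈ G, ∀ x ∈ s, g x = π x := by
  have hG := hG.exists_smul_eq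
  let e : Fin k ↪ α := (s.equivFinOfCardEq hs).symm.toEmbedding.trans (Function.Embedding.subtype _)
  obtain ⟨g, hg⟩ := hG e (e.trans π.toEmbedding)
  refine ⟨g, g.2, fun x hx => ?_⟩
  have := congrArg (fun f : Fin k ↪ α => f (s.equivFinOfCardEq hs ⟨x, hx⟩)) hg
  simpa [e] using! this

variable [Fintype α] [DecidableEq α]

/-- The pointwise stabilizer of the fixed points contains `c`, so it is transitive on the `p` moved
points and, `p` being prime, primitive there. Jordan's criterion then yields one degree of
transitivity more than is kept here. -/
theorem isMultiplyPretransitive_of_prime_cycle_mem (hG : IsPreprimitive G α) {p : ℕ} (hp : p.Prime)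
    (hp' : p + 1 ≤ Fintype.card α) {c : Equiv.Perm α} (hc : c.IsCycle) (hcp : c.support.card = p)
    (hcG : c ∈ G) : IsMultiplyPretransitive G α (Fintype.card α - p) := by
  have h1 := isPretransitive_of_isCycle_mem hc hcG
  have hprim : IsPreprimitive (fixingSubgroup G (c.support : Set α)ᶜ)
      (SubMulAction.ofFixingSubgroup G (c.support : Set α)ᶜ) := by
    apply IsPreprimitive.of_prime_card
    convert! hp
    classical
    rw [Nat.card_eq_fintype_card, Fintype.card_subtype, ← hcp]
    congr 1
    ext x
    rw [Finset.mem_filter, SubMulAction.mem_ofFixingSubgroup_iff]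
    simp
  have hp2 := hp.two_le
  have h2 := hG.isMultiplyPreprimitive (s := (c.support : Set α)ᶜ) (n := Fintype.card α - p - 1)
    (by
      rw [← Finset.coe_compl, Set.ncard_coe_finset, Finset.card_compl, hcp]; omega)
    (by rw [Nat.card_eq_fintype_card]; omega) hprim
  have h3 : IsMultiplyPretransitive G α (Fintype.card α - p - 1 + 2) := h2.isMultiplyPretransitive
  exact isMultiplyPretransitive_of_le (n := Fintype.card α - p - 1 + 2) (by omega)
    (by rw [Nat.card_eq_fintype_card]; omega)

theorem card_dvd_factorial_of_support_subset {T : Subgroup (Equiv.Perm α)} {s : Finset α}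
    (hT : ∀ t ∈ T, t.support ⊆ s) : Nat.card T ∣ s.card.factorial := by
  have h : T ≤ (Equiv.Perm.ofSubtype (p := fun x => x ∈ s)).range := by
    intro t ht
    refine ⟨t.subtypePerm (p := fun x => x ∈ s) fun x => ?_, ?_⟩
    · by_cases hx : x ∈ t.support
      · exact ⟨fun _ => hT t ht hx, fun _ => hT t ht (apply_mem_support.2 hx)⟩
      · rw [notMem_support.1 hx]
    · exact ofSubtype_subtypePerm _ fun x hx => hT t ht (mem_support.2 hx)
  have h2 := Subgroup.card_dvd_of_le h
  rwa [Nat.card_congr ((MonoidHom.ofInjective ofSubtype_injective).toEquiv.symm),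
    Nat.card_perm, Nat.card_eq_finsetCard] at h2

/-- A primitive permutation group with a `p`-cycle `c` induces every permutation of the fixed
points of `c` by elements that normalize the group generated by `c`. -/
theorem exists_mem_conj_mem_zpowers_eqOn (hG : IsPreprimitive G α) {p : ℕ} (hp : p.Prime)
    (hp' : p + 1 ≤ Fintype.card α) {c : Equiv.Perm α} (hc : c.IsCycle) (hcp : c.support.card = p)
    (hcG : c ∈ G) (π : Equiv.Perm α) (hπ : ∀ x ∉ c.support, π x ∉ c.support) :
    ∃ g ∈ G, (∀ x ∉ c.support, g x = π x) ∧ g * c * g⁻¹ ∈ Subgroup.zpowers c := by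
  obtain ⟨g, hgG, hg⟩ := exists_mem_eqOn_of_isMultiplyPretransitive (s := c.supportᶜ)
    (isMultiplyPretransitive_of_prime_cycle_mem hG hp hp' hc hcp hcG)
    (by rw [Finset.card_compl, hcp]) π
  simp only [Finset.mem_compl] at hg
  -- Frattini argument: `T` is the pointwise stabilizer in `G` of the fixed points of `c`. It
  -- contains `c` and `g * c * g⁻¹`, and its order divides p!, so a correction of `g` by an element
  -- of `T` brings the conjugate into the group generated by `c`.
  let T : Subgroup (Equiv.Perm α) :=
    { carrier := {t | t ∈ G ∧ ∀ x ∉ c.support, t x = x}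
      mul_mem' := fun {a b} ha hb => ⟨G.mul_mem ha.1 hb.1, fun x hx => by
        rw [mul_apply, hb.2 x hx, ha.2 x hx]⟩
      one_mem' := ⟨G.one_mem, fun _ _ => rfl⟩
      inv_mem' := fun {a} ha => ⟨G.inv_mem ha.1, fun x hx => by
        rw [inv_eq_iff_eq, ha.2 x hx]⟩ }
  have hcT : c ∈ T := ⟨hcG, fun x hx => notMem_support.1 hx⟩
  have hc' : g * c * g⁻¹ ∈ T := by
    refine ⟨G.mul_mem (G.mul_mem hgG hcG) (G.inv_mem hgG), fun x hx => ?_⟩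
    have hinv : g⁻¹ x ∉ c.support := by
      have hmaps : Finset.image π c.supportᶜ = c.supportᶜ := by
        apply Finset.eq_of_subset_of_card_le
        · intro y hy
          obtain ⟨z, hz, rfl⟩ := Finset.mem_image.1 hy
          exact Finset.mem_compl.2 (hπ z (Finset.mem_compl.1 hz))
        · rw [Finset.card_image_of_injective _ π.injective]
      have : x ∈ Finset.image π c.supportᶜ := by rw [hmaps]; exact Finset.mem_compl.2 hx
      obtain ⟨z, hz, rfl⟩ := Finset.mem_image.1 this
      simpa [← hg z (Finset.mem_compl.1 hz)] using hz
    rw [mul_apply, mul_apply, notMem_support.1 hinv, ← mul_apply, mul_inv_cancel, one_apply]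
  have hcard : ¬ p ^ 2 ∣ Nat.card T := by
    intro h
    have h1 := h.trans (card_dvd_factorial_of_support_subset (T := T) (s := c.support)
      fun t ht x hx => by
        by_contra hxc
        exact mem_support.1 hx (ht.2 x hxc))
    rw [hcp, ← Nat.mul_factorial_pred hp.ne_zero, pow_two] at h1
    have h2 := (hp.dvd_factorial).1 (Nat.dvd_of_mul_dvd_mul_left hp.pos h1)
    have := hp.pos
    omega
  have ho : orderOf c = p := by rw [hc.orderOf, hcp]
  obtain ⟨t, ht⟩ := exists_conj_mem_zpowers_of_not_sq_dvd_card hp hcard (c := (⟨c, hcT⟩ : T))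
    (c' := (⟨g * c * g⁻¹, hc'⟩ : T)) (by rw [Subgroup.orderOf_mk, ho])
    (by rw [Subgroup.orderOf_mk, ← ho, ← MulAut.conj_apply]; exact (MulAut.conj g).orderOf_eq c)
  obtain ⟨k, hk⟩ := Subgroup.mem_zpowers_iff.1 ht
  refine ⟨t * g, G.mul_mem t.2.1 hgG, fun x hx => ?_, Subgroup.mem_zpowers_iff.2 ⟨k, ?_⟩⟩
  · rw [mul_apply, hg x hx, t.2.2 _ (hπ x hx)]
  · have := congrArg (fun y : T => (y : Equiv.Perm α)) hk
    simp only [Subgroup.coe_zpow, Subgroup.coe_mul, Subgroup.coe_inv] at this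
    rw [this]
    group

/-- A primitive permutation group that contains a cycle of prime length with at least three fixed
points contains the alternating group (Jordan). -/
theorem alternatingGroup_le_of_isPreprimitive_of_prime_cycle_mem (hG : IsPreprimitive G α) {p : ℕ}
    (hp : p.Prime) (hp' : p + 3 ≤ Fintype.card α) {c : Equiv.Perm α} (hc : c.IsCycle)
    (hcp : c.support.card = p) (hcG : c ∈ G) : alternatingGroup α ≤ G := by
  obtain ⟨a, b, d, ha, hb, hd, hab, had, hbd⟩ : ∃ a b d, a ∈ c.supportᶜ ∧ b ∈ c.supportᶜ ∧
      d ∈ c.supportᶜ ∧ a ≠ b ∧ a ≠ d ∧ b ≠ d := by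
    apply Finset.two_lt_card_iff.1
    rw [Finset.card_compl, hcp]
    omega
  rw [Finset.mem_compl] at ha hb hd
  have hswap : ∀ {u v : α}, u ∉ c.support → v ∉ c.support → ∀ x ∉ c.support,
      Equiv.swap u v x ∉ c.support := by
    intro u v hu hv x hx
    rw [Equiv.swap_apply_def]
    split_ifs <;> assumption
  obtain ⟨g, hgG, hg, hgc⟩ := exists_mem_conj_mem_zpowers_eqOn hG hp (by omega) hc hcp hcG
    (Equiv.swap a b) (hswap ha hb)
  obtain ⟨h, hhG, hh, hhc⟩ := exists_mem_conj_mem_zpowers_eqOn hG hp (by omega) hc hcp hcG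
    (Equiv.swap b d) (hswap hb hd)
  obtain ⟨i, hi⟩ := Subgroup.mem_zpowers_iff.1 hgc
  obtain ⟨j, hj⟩ := Subgroup.mem_zpowers_iff.1 hhc
  -- Conjugation by `g` and by `h` acts on the powers of `c` through exponents `i` and `j`. These
  -- actions commute, so the commutator `u` of `g` and `h` centralizes `c`.
  have e1 : (g * h) * c * (g * h)⁻¹ = c ^ (i * j) := by
    rw [show (g * h) * c * (g * h)⁻¹ = g * (h * c * h⁻¹) * g⁻¹ by group, ← hj, ← conj_zpow, ← hi,
      zpow_mul]
  have e2 : (h * g) * c * (h * g)⁻¹ = c ^ (i * j) := by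
    rw [show (h * g) * c * (h * g)⁻¹ = h * (g * c * g⁻¹) * h⁻¹ by group, ← hi, ← conj_zpow, ← hj,
      ← zpow_mul, mul_comm]
  set u := (h * g)⁻¹ * (g * h) with hu
  have huc : u * c = c * u := by
    have : (g * h) * c = (h * g) * c * (h * g)⁻¹ * (g * h) := by
      rw [e2, ← e1, inv_mul_cancel_right]
    rw [hu, mul_assoc, this]
    group
  obtain ⟨x₀, hx₀, hcyc⟩ := hc
  have hux : c (u x₀) ≠ u x₀ := by
    rw [← mul_apply, ← huc, mul_apply]
    exact fun h' => hx₀ (u.injective h')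
  -- A permutation commuting with the cycle `c` agrees on its support with a power of `c`. Removing
  -- this power from `u` leaves only the commutator of the two transpositions, which is a
  -- three-cycle on `a`, `b`, `d`.
  obtain ⟨k, hk⟩ := hcyc hux
  have hw : (c ^ k)⁻¹ * u = (Equiv.swap a b * Equiv.swap b d) * (Equiv.swap a b * Equiv.swap b d) := by
    ext x
    by_cases hx : x ∈ c.support
    · obtain ⟨l, rfl⟩ := hcyc (mem_support.1 hx)
      have e3 : u * c ^ l = c ^ l * u := ((show Commute u c from huc).zpow_right l).eq
      rw [mul_apply, ← mul_apply u, e3, mul_apply, ← hk, inv_eq_iff_eq, ← mul_apply, ← mul_apply,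
        ← zpow_add, add_comm l k]
      have hne : ∀ {v}, v ∉ c.support → (c ^ l) x₀ ≠ v := fun hv h' => hv (h' ▸ hx)
      simp only [mul_apply, Equiv.swap_apply_of_ne_of_ne (hne ha) (hne hb),
        Equiv.swap_apply_of_ne_of_ne (hne hb) (hne hd)]
      rw [zpow_add, mul_apply]
    · have hfix : ∀ y ∉ c.support, (c ^ k)⁻¹ y = y := fun y hy => by
        rw [inv_eq_iff_eq, zpow_apply_eq_self_of_apply_eq_self (notMem_support.1 hy)]
      have hginv : ∀ y ∉ c.support, g⁻¹ y = Equiv.swap a b y := fun y hy => by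
        rw [inv_eq_iff_eq, hg _ (hswap ha hb y hy), Equiv.swap_apply_self]
      have hhinv : ∀ y ∉ c.support, h⁻¹ y = Equiv.swap b d y := fun y hy => by
        rw [inv_eq_iff_eq, hh _ (hswap hb hd y hy), Equiv.swap_apply_self]
      have h1 := hswap hb hd x hx
      have h2 := hswap ha hb _ h1
      have h3 := hswap hb hd _ h2
      have h4 := hswap ha hb _ h3
      rw [hu, mul_inv_rev]
      simp only [mul_apply]
      rw [hh x hx, hg _ h1, hhinv _ h2, hginv _ h3, hfix _ h4]
  have h3 : IsThreeCycle ((c ^ k)⁻¹ * u) := by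
    rw [hw]
    apply IsThreeCycle.isThreeCycle_sq
    rw [Equiv.swap_comm a b]
    exact isThreeCycle_swap_mul_swap_same hab.symm hbd had
  refine alternatingGroup_le_of_isPreprimitive_of_isThreeCycle_mem hG h3 ?_
  exact G.mul_mem (G.inv_mem (G.zpow_mem hcG k))
    (G.mul_mem (G.inv_mem (G.mul_mem hhG hgG)) (G.mul_mem hgG hhG))

end Jordan
-- Cycle types in intransitive, imprimitive and primitive groups
section CycleTypes

variable {α : Type*} [Fintype α] [DecidableEq α]

/-- The subgroup `H` contains a permutation whose cycle lengths, fixed points included, are `l`. -/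
def HasType (H : Subgroup (Equiv.Perm α)) (l : Multiset ℕ) : Prop :=
  ∃ σ ∈ H, σ.partition.parts = l

theorem filter_one_eq_replicate {l : Multiset ℕ} (hl : ∀ x ∈ l, 0 < x) :
    l.filter (fun x => ¬ 2 ≤ x) = Multiset.replicate (l.filter fun x => ¬ 2 ≤ x).card 1 := by
  rw [Multiset.eq_replicate]
  refine ⟨rfl, fun b hb => ?_⟩
  have := hl b (Multiset.mem_of_mem_filter hb)
  have := Multiset.of_mem_filter hb
  omega

theorem exists_mem_alternatingGroup_parts_eq {l : Multiset ℕ} (hl : ∀ x ∈ l, 0 < x)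
    (hsum : l.sum = Fintype.card α) (heven : Even (Fintype.card α + l.card)) :
    ∃ σ ∈ alternatingGroup α, σ.partition.parts = l := by
  have h1 := filter_one_eq_replicate hl
  have h2 := Multiset.filter_add_not (fun x => 2 ≤ x) l
  set m := l.filter fun x => 2 ≤ x
  set r := (l.filter fun x => ¬ 2 ≤ x).card
  rw [h1] at h2
  have hs : m.sum + r = Fintype.card α := by
    rw [← hsum, ← h2, Multiset.sum_add, Multiset.sum_replicate]; simp
  have hc : l.card = m.card + r := by rw [← h2]; simp
  obtain ⟨σ, hσ⟩ := (exists_with_cycleType_iff α (m := m)).2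
    ⟨by omega, fun a ha => Multiset.of_mem_filter ha⟩
  refine ⟨σ, ?_, ?_⟩
  · rw [mem_alternatingGroup, sign_of_cycleType, hσ, Even.neg_one_pow]
    rw [hc, ← hs] at heven
    rcases heven with ⟨k, hk⟩
    exact ⟨k - r, by omega⟩
  · rw [parts_partition, ← sum_cycleType, hσ, show Fintype.card α - m.sum = r by omega, h2]

theorem exists_cycle_factor {σ : Equiv.Perm α} {q : ℕ} {s : Multiset ℕ} (hq : 2 ≤ q)
    (hσ : σ.partition.parts = q ::ₘ s) : ∃ c τ : Equiv.Perm α, Disjoint τ c ∧ σ = τ * c ∧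
      c.IsCycle ∧ c.support.card = q ∧ τ.cycleType = s.filter fun x => 2 ≤ x := by
  have hct := filter_parts_partition_eq_cycleType (σ := σ)
  rw [hσ, Multiset.filter_cons_of_pos _ hq] at hct
  have hmem : q ∈ σ.cycleType := by rw [← hct]; exact Multiset.mem_cons_self _ _
  rw [cycleType_def, Multiset.mem_map] at hmem
  obtain ⟨c, hc, hcq⟩ := hmem
  have hc' : c ∈ σ.cycleFactorsFinset := hc
  have hcyc : c.IsCycle := (mem_cycleFactorsFinset_iff.1 hc').1
  simp only [Function.comp_apply] at hcq
  have hτ := cycleType_mul_inv_mem_cycleFactorsFinset_eq_sub hc'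
  rw [hcyc.cycleType, hcq, ← hct, ← Multiset.singleton_add, add_tsub_cancel_left] at hτ
  exact ⟨c, σ * c⁻¹, disjoint_mul_inv_of_mem_cycleFactorsFinset hc', by group, hcyc, hcq, hτ⟩

/-- Raising to the order of the remaining factor kills that factor; this exponent is coprime to `q`,
so the cycle of length `q` stays a cycle. -/
theorem exists_isCycle_mem_of_hasType {H : Subgroup (Equiv.Perm α)} {q : ℕ} {s : Multiset ℕ}
    (hq : 2 ≤ q) (hs : ∀ x ∈ s, Nat.Coprime q x) (hH : HasType H (q ::ₘ s)) :
    ∃ c ∈ H, c.IsCycle ∧ c.support.card = q := by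
  obtain ⟨σ, hσ, hparts⟩ := hH
  obtain ⟨c, τ, hdis, rfl, hcyc, hcq, hτ⟩ := exists_cycle_factor hq hparts
  have hpow : (τ * c) ^ orderOf τ = c ^ orderOf τ := by
    rw [hdis.commute.mul_pow, pow_orderOf_eq_one, one_mul]
  have hcop : (orderOf τ).Coprime (orderOf c) := by
    rw [hcyc.orderOf, hcq, ← lcm_cycleType, hτ]
    have : ∀ t : Multiset ℕ, (∀ x ∈ t, Nat.Coprime q x) → t.lcm.Coprime q := by
      intro t
      induction t using Multiset.induction with
      | empty => intro _; simp
      | cons a t ih =>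
        intro h
        rw [Multiset.lcm_cons]
        exact Nat.Coprime.coprime_dvd_left (lcm_dvd_mul _ _)
          (Nat.Coprime.mul_left (h a (Multiset.mem_cons_self _ _)).symm
            (ih fun x hx => h x (Multiset.mem_cons_of_mem hx)))
    exact this _ fun x hx => hs x (Multiset.mem_of_mem_filter hx)
  refine ⟨(τ * c) ^ orderOf τ, H.pow_mem hσ _, ?_, ?_⟩
  · rw [hpow]
    exact hcyc.pow_iff.2 hcop
  · rw [hpow, support_pow_coprime hcop, hcq]

/-- An invariant set is a union of cycles, fixed points included: the required parts are those of
the restriction of `σ` to `S`. -/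
theorem exists_le_parts_sum_eq_card (σ : Equiv.Perm α) (S : Finset α)
    (hS : ∀ x, σ x ∈ S ↔ x ∈ S) : ∃ t ≤ σ.partition.parts, t.sum = S.card := by
  set a := σ.subtypePerm (p := fun x => x ∈ S) hS with ha
  set b := σ.subtypePerm (p := fun x => ¬ x ∈ S) (fun x => not_congr (hS x)) with hb
  have hdis : Disjoint (ofSubtype a) (ofSubtype b) := by
    intro x
    by_cases hx : x ∈ S
    · exact Or.inr (ofSubtype_apply_of_not_mem b (by simpa using hx))
    · exact Or.inl (ofSubtype_apply_of_not_mem a hx)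
  have hmul : σ = ofSubtype a * ofSubtype b := by
    ext x
    by_cases hx : x ∈ S
    · rw [mul_apply, ofSubtype_apply_of_not_mem b (by simpa using hx), ofSubtype_apply_of_mem a hx]
      rfl
    · rw [mul_apply, ofSubtype_apply_of_mem b hx, ofSubtype_apply_of_not_mem]
      · rfl
      · exact (b ⟨x, hx⟩).2
  have hct : σ.cycleType = a.cycleType + b.cycleType := by
    conv_lhs => rw [hmul]
    rw [hdis.cycleType_mul, cycleType_ofSubtype, cycleType_ofSubtype]
  refine ⟨a.partition.parts, ?_, by rw [a.partition.parts_sum, Fintype.card_coe]⟩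
  rw [parts_partition, parts_partition, hct]
  refine add_le_add (Multiset.le_add_right _ _) ?_
  rw [Multiset.replicate_le_replicate]
  have h1 : σ.support.card = a.support.card + b.support.card := by
    rw [← sum_cycleType, ← sum_cycleType, ← sum_cycleType, hct, Multiset.sum_add]
  have h2 : b.support.card ≤ Fintype.card {x // x ∉ S} := Finset.card_le_univ _
  have h3 : Fintype.card {x // x ∉ S} = Fintype.card α - S.card := by
    rw [Fintype.card_subtype_compl, Fintype.card_coe]
  rw [Fintype.card_coe]
  have := Finset.card_le_univ S
  have : a.support.card ≤ S.card := by simpa using Finset.card_le_univ a.support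
  omega

theorem exists_card_of_not_isPretransitive {H : Subgroup (Equiv.Perm α)}
    (hH : ¬ IsPretransitive H α) : ∃ k, 0 < k ∧ k < Fintype.card α ∧
      ∀ l, HasType H l → ∃ t ≤ l, t.sum = k := by
  classical
  rw [isPretransitive_iff] at hH
  push Not at hH
  obtain ⟨x, y, hxy⟩ := hH
  let S : Finset α := Finset.univ.filter fun z => z ∈ orbit H x
  refine ⟨S.card, Finset.card_pos.2 ⟨x, by simp [S]⟩, ?_, ?_⟩
  · apply Finset.card_lt_univ_of_notMem (x := y)
    simpa [S, mem_orbit_iff] using! hxy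
  · rintro l ⟨σ, hσ, rfl⟩
    apply exists_le_parts_sum_eq_card
    intro z
    have : σ z = (⟨σ, hσ⟩ : H) • z := rfl
    simp only [S, Finset.mem_filter, Finset.mem_univ, true_and]
    rw [this, ← orbit_eq_iff, orbit_smul, orbit_eq_iff]

/-- The fixed points of `c` form a union of translates of `B`. A translate containing both a fixed
and a moved point would be stable under `c`, hence would contain the whole support and one more
point, which is too many. -/
theorem ncard_block_dvd_card_sub_support {H : Subgroup (Equiv.Perm α)} [IsPretransitive H α]
    {B : Set α} (hB : IsBlock H B) (hBne : B.Nonempty) {c : Equiv.Perm α} (hcH : c ∈ H)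
    (hc : c.IsCycle) (hcard : B.ncard ≤ c.support.card) :
    B.ncard ∣ Fintype.card α - c.support.card := by
  classical
  have hsys := (hB.isBlockSystem hBne).1
  choose φ hφ hφu using hsys.2
  simp only [Set.mem_range] at hφ hφu
  have hsize : ∀ x, (φ x).ncard = B.ncard := by
    intro x
    obtain ⟨g, hg⟩ := (hφ x).1
    rw [← hg, Set.ncard_smul_set]
  have huniq : ∀ x y, y ∈ φ x → φ y = φ x := fun x y hy => (hφu y _ ⟨(hφ x).1, hy⟩).symm
  have hsub : ∀ x ∈ c.supportᶜ, φ x ⊆ (c.supportᶜ : Finset α) := by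
    intro x hx y hy
    by_contra hyc
    have hyc : y ∈ c.support := by simpa using hyc
    have hcφ : ∀ z ∈ φ x, ∀ i : ℤ, (c ^ i) z ∈ φ x := by
      intro z hz i
      have hfix : (c ^ i) x = x :=
        zpow_apply_eq_self_of_apply_eq_self (notMem_support.1 (Finset.mem_compl.1 hx)) i
      obtain ⟨g, hg⟩ := (hφ x).1
      have hmem : ∀ w ∈ φ x, (c ^ i) w ∈ ((⟨c ^ i, H.zpow_mem hcH i⟩ : H) * g) • B := by
        intro w hw
        rw [mul_smul, hg]
        exact Set.smul_mem_smul_set (a := (⟨c ^ i, H.zpow_mem hcH i⟩ : H)) hw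
      rw [← hφu x _ ⟨⟨_, rfl⟩, by simpa only [hfix] using hmem x (hφ x).2⟩]
      exact hmem z hz
    have hle : ((insert x c.support : Finset α) : Set α) ⊆ φ x := by
      intro z hz
      rw [Finset.mem_coe, Finset.mem_insert] at hz
      rcases hz with rfl | hz
      · exact (hφ z).2
      · obtain ⟨i, rfl⟩ := hc.exists_zpow_eq (mem_support.1 hyc) (mem_support.1 hz)
        exact hcφ y hy i
    have h1 := Set.ncard_le_ncard hle (Set.toFinite _)
    rw [Set.ncard_coe_finset, Finset.card_insert_of_notMem (Finset.mem_compl.1 hx), hsize] at h1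
    omega
  rw [← Finset.card_compl, Finset.card_eq_sum_card_image φ]
  apply Finset.dvd_sum
  intro β hβ
  obtain ⟨x, hx, rfl⟩ := Finset.mem_image.1 hβ
  apply dvd_of_eq
  rw [← hsize x, ← Set.ncard_coe_finset]
  congr 1
  ext y
  simp only [Finset.coe_filter, Set.mem_ofPred_eq]
  constructor
  · exact fun hy => ⟨by simpa using hsub x hx hy, huniq x y hy⟩
  · exact fun hy => hy.2 ▸ (hφ y).2

/-- A permutation group that does not contain the alternating group is intransitive, imprimitive or
primitive; each alternative restricts the cycle lengths of its elements. -/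
theorem intransitive_or_imprimitive_or_primitive (H : Subgroup (Equiv.Perm α))
    (hH : ¬ alternatingGroup α ≤ H) :
    (∃ k, 0 < k ∧ k < Fintype.card α ∧ ∀ l, HasType H l → ∃ t ≤ l, t.sum = k) ∨
    (∃ d, 1 < d ∧ d < Fintype.card α ∧ d ∣ Fintype.card α ∧ ∀ q s, 2 ≤ q →
      (∀ x ∈ s, Nat.Coprime q x) → HasType H (q ::ₘ s) → d ≤ q → d ∣ Fintype.card α - q) ∨
    (IsPreprimitive H α ∧ ∀ q s, q.Prime → q + 3 ≤ Fintype.card α →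
      (∀ x ∈ s, Nat.Coprime q x) → ¬ HasType H (q ::ₘ s)) := by
  by_cases htr : IsPretransitive H α
  · right
    by_cases hprim : IsPreprimitive H α
    · refine Or.inr ⟨hprim, fun q s hq hn hs h => hH ?_⟩
      obtain ⟨c, hcH, hc, hcq⟩ := exists_isCycle_mem_of_hasType hq.two_le hs h
      exact alternatingGroup_le_of_isPreprimitive_of_prime_cycle_mem hprim hq hn hc hcq hcH
    · left
      obtain ⟨B, hB, hBtriv⟩ : ∃ B : Set α, IsBlock H B ∧ ¬ IsTrivialBlock B := by
        by_contra! h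
        exact hprim ⟨fun {B} hB => h B hB⟩
      rw [IsTrivialBlock, not_or, Set.not_subsingleton_iff] at hBtriv
      have hne := hBtriv.1.nonempty
      refine ⟨B.ncard, Set.one_lt_ncard_iff_nontrivial.2 hBtriv.1, ?_, ?_, ?_⟩
      · rw [← Nat.card_eq_fintype_card, ← Set.ncard_univ]
        exact Set.ncard_lt_ncard (Set.ssubset_univ_iff.2 hBtriv.2)
      · rw [← Nat.card_eq_fintype_card]
        exact hB.ncard_dvd_card hne
      · intro q s hq hs h hd
        obtain ⟨c, hcH, hc, rfl⟩ := exists_isCycle_mem_of_hasType hq hs h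
        exact ncard_block_dvd_card_sub_support hB hne hcH hc hd
  · exact Or.inl (exists_card_of_not_isPretransitive htr)

end CycleTypes
-- Arithmetic of cycle types: only degrees 9, 10 and 12 remain
section Arithmetic

/-- Every multiset in `p` has a part with sum `k`. -/
def HasPartialSum (p : Multiset ℕ → Prop) (k : ℕ) : Prop :=
  ∀ l, p l → ∃ t ≤ l, t.sum = k

/-- The restriction on cycle lengths coming from a block of size `d`. -/
def HasBlockSize (n : ℕ) (p : Multiset ℕ → Prop) (d : ℕ) : Prop :=
  1 < d ∧ d < n ∧ d ∣ n ∧ ∀ q s, 2 ≤ q → (∀ x ∈ s, Nat.Coprime q x) → p (q ::ₘ s) → d ≤ q →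
    d ∣ n - q

/-- No multiset in `p` comes from a permutation with a power that is a cycle of prime length with
at least three fixed points. -/
def AvoidsPrimeCycle (n : ℕ) (p : Multiset ℕ → Prop) : Prop :=
  ∀ q s, q.Prime → q + 3 ≤ n → (∀ x ∈ s, Nat.Coprime q x) → ¬ p (q ::ₘ s)

/-- Each even cycle type of degree `n` belongs to `p` or to `q`. -/
def CoversEvenTypes (n : ℕ) (p q : Multiset ℕ → Prop) : Prop :=
  ∀ l : Multiset ℕ, (∀ x ∈ l, 0 < x) → l.sum = n → Even (n + l.card) → p l ∨ q l

theorem CoversEvenTypes.symm {n : ℕ} {p q : Multiset ℕ → Prop} (h : CoversEvenTypes n p q) :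
    CoversEvenTypes n q p := fun l h1 h2 h3 => (h l h1 h2 h3).symm

theorem le_cons_sum {a k : ℕ} {s : Multiset ℕ} (h : ∃ t ≤ a ::ₘ s, t.sum = k) :
    (∃ t ≤ s, t.sum = k) ∨ ∃ j, k = a + j ∧ ∃ t ≤ s, t.sum = j := by
  obtain ⟨t, ht, rfl⟩ := h
  rw [← Multiset.mem_powerset, Multiset.powerset_cons, Multiset.mem_add, Multiset.mem_map] at ht
  rcases ht with ht | ⟨t', ht', rfl⟩
  · exact Or.inl ⟨t, Multiset.mem_powerset.1 ht, rfl⟩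
  · exact Or.inr ⟨t'.sum, by simp, t', Multiset.mem_powerset.1 ht', rfl⟩

theorem le_singleton_sum {a k : ℕ} (h : ∃ t ≤ ({a} : Multiset ℕ), t.sum = k) : k = 0 ∨ k = a := by
  obtain ⟨t, ht, rfl⟩ := h
  rcases Multiset.le_singleton.1 ht with rfl | rfl <;> simp

theorem le_pair_sum {a b k : ℕ} (h : ∃ t ≤ ({a, b} : Multiset ℕ), t.sum = k) :
    k = 0 ∨ k = b ∨ k = a ∨ k = a + b := by
  rcases le_cons_sum h with h | ⟨j, hj, h⟩ <;> have := le_singleton_sum h <;> omega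

theorem le_triple_sum {a b c k : ℕ} (h : ∃ t ≤ ({a, b, c} : Multiset ℕ), t.sum = k) :
    k = 0 ∨ k = c ∨ k = b ∨ k = b + c ∨ k = a ∨ k = a + c ∨ k = a + b ∨ k = a + b + c := by
  rcases le_cons_sum h with h | ⟨j, hj, h⟩ <;> have := le_pair_sum h <;> omega

theorem le_quadruple_sum {a b c d k : ℕ} (h : ∃ t ≤ ({a, b, c, d} : Multiset ℕ), t.sum = k) :
    (k = 0 ∨ k = d ∨ k = c ∨ k = c + d ∨ k = b ∨ k = b + d ∨ k = b + c ∨ k = b + c + d) ∨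
    (k = a ∨ k = a + d ∨ k = a + c ∨ k = a + c + d ∨ k = a + b ∨ k = a + b + d ∨ k = a + b + c ∨
      k = a + b + c + d) := by
  rcases le_cons_sum h with h | ⟨j, hj, h⟩ <;> have := le_triple_sum h <;> omega

theorem triple_rotate (a b c : ℕ) : ({a, b, c} : Multiset ℕ) = {c, a, b} := by
  simp only [← Multiset.singleton_add, Multiset.insert_eq_cons]
  abel

theorem quadruple_rotate (a b c d : ℕ) : ({a, b, c, d} : Multiset ℕ) = {d, a, b, c} := by
  simp only [← Multiset.singleton_add, Multiset.insert_eq_cons]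
  abel

section

variable {n : ℕ} {p q : Multiset ℕ → Prop} {d : ℕ}

theorem CoversEvenTypes.single (h : CoversEvenTypes n p q) (hn : n % 2 = 1) : p {n} ∨ q {n} := by
  apply h _ _ (by simp) (by simp [Nat.even_iff]; omega)
  intro x hx
  rw [Multiset.mem_singleton] at hx
  omega

theorem CoversEvenTypes.pair (h : CoversEvenTypes n p q) (hn : n % 2 = 0) (a b : ℕ) (ha : 0 < a)
    (hb : 0 < b) (hs : a + b = n) : p {a, b} ∨ q {a, b} := by
  apply h _ (by simp [ha, hb]) (by simp [hs]) (by simp [Nat.even_iff]; omega)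

theorem CoversEvenTypes.triple (h : CoversEvenTypes n p q) (hn : n % 2 = 1) (a b c : ℕ) (ha : 0 < a)
    (hb : 0 < b) (hc : 0 < c) (hs : a + b + c = n) : p {a, b, c} ∨ q {a, b, c} := by
  apply h _ (by simp [ha, hb, hc]) (by simp; omega) (by simp [Nat.even_iff]; omega)

theorem CoversEvenTypes.quadruple (h : CoversEvenTypes n p q) (hn : n % 2 = 0) (a b c d : ℕ)
    (ha : 0 < a) (hb : 0 < b) (hc : 0 < c) (hd : 0 < d) (hs : a + b + c + d = n) :
    p {a, b, c, d} ∨ q {a, b, c, d} := by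
  apply h _ (by simp [ha, hb, hc, hd]) (by simp; omega) (by simp [Nat.even_iff]; omega)

/-- The working principle of the arithmetic: a type excluded from `p` by its prime part must be
provided by `q`. -/
theorem AvoidsPrimeCycle.pair (h : AvoidsPrimeCycle n p) (hcov : CoversEvenTypes n p q)
    (hn : n % 2 = 0) (r b : ℕ) (hr : r.Prime) (hb : 3 ≤ b) (hs : r + b = n) (hrb : ¬ r ∣ b) :
    q {r, b} := by
  refine (hcov.pair hn r b hr.pos (by omega) hs).resolve_left (h r _ hr (by omega) ?_)
  simpa using (hr.coprime_iff_not_dvd).2 hrb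

theorem AvoidsPrimeCycle.triple (h : AvoidsPrimeCycle n p) (hcov : CoversEvenTypes n p q)
    (hn : n % 2 = 1) (r b c : ℕ) (hr : r.Prime) (hb : 0 < b) (hc : 0 < c) (hbc : 3 ≤ b + c)
    (hs : r + b + c = n) (hrb : ¬ r ∣ b) (hrc : ¬ r ∣ c) : q {r, b, c} := by
  refine (hcov.triple hn r b c hr.pos hb hc hs).resolve_left (h r _ hr (by omega) ?_)
  simpa using And.intro ((hr.coprime_iff_not_dvd).2 hrb) ((hr.coprime_iff_not_dvd).2 hrc)

theorem AvoidsPrimeCycle.quadruple (h : AvoidsPrimeCycle n p) (hcov : CoversEvenTypes n p q)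
    (hn : n % 2 = 0) (r b c d : ℕ) (hr : r.Prime) (hb : 0 < b) (hc : 0 < c) (hd : 0 < d)
    (hs : r + b + c + d = n) (hrb : ¬ r ∣ b) (hrc : ¬ r ∣ c) (hrd : ¬ r ∣ d) :
    q {r, b, c, d} := by
  refine (hcov.quadruple hn r b c d hr.pos hb hc hd hs).resolve_left (h r _ hr (by omega) ?_)
  simpa using And.intro ((hr.coprime_iff_not_dvd).2 hrb)
    (And.intro ((hr.coprime_iff_not_dvd).2 hrc) ((hr.coprime_iff_not_dvd).2 hrd))

theorem HasBlockSize.two_mul_le (h : HasBlockSize n p d) : 2 * d ≤ n := by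
  obtain ⟨h1, h2, ⟨e, he⟩, -⟩ := h
  have : 2 ≤ e := by
    by_contra hlt
    interval_cases e <;> omega
  rw [he, mul_comm]
  exact Nat.mul_le_mul_left d this

theorem HasBlockSize.three_mul_le (h : HasBlockSize n p d) (hn : n % 2 = 1) : 3 * d ≤ n := by
  obtain ⟨h1, h2, ⟨e, he⟩, -⟩ := h
  have : 3 ≤ e := by
    by_contra hlt
    interval_cases e <;> omega
  rw [he, mul_comm]
  exact Nat.mul_le_mul_left d this

/-- In this and the next two lemmas the last part is the long cycle that survives in a power. The
block size then divides the sum of the short parts, which can be bounded independently of `n`. -/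
theorem HasBlockSize.dvd_of_pair (h : HasBlockSize n p d) {a b : ℕ} (hp : p {a, b})
    (hs : a + b = n) (hb : 2 ≤ b) (hd : d ≤ b) (hba : b.Coprime a) : d ∣ a := by
  rw [Multiset.pair_comm] at hp
  have := h.2.2.2 b {a} hb (by simpa using hba) hp hd
  rwa [show n - b = a by omega] at this

theorem HasBlockSize.dvd_of_triple (h : HasBlockSize n p d) {a b c : ℕ} (hp : p {a, b, c})
    (hs : a + b + c = n) (hc : 2 ≤ c) (hd : d ≤ c) (hca : c.Coprime a) (hcb : c.Coprime b) :
    d ∣ a + b := by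
  rw [triple_rotate] at hp
  have := h.2.2.2 c {a, b} hc (by simpa using And.intro hca hcb) hp hd
  rwa [show n - c = a + b by omega] at this

theorem HasBlockSize.dvd_of_quadruple (h : HasBlockSize n p d) {a b c e : ℕ} (hp : p {a, b, c, e})
    (hs : a + b + c + e = n) (he : 2 ≤ e) (hd : d ≤ e) (hea : e.Coprime a) (heb : e.Coprime b)
    (hec : e.Coprime c) : d ∣ a + b + c := by
  rw [quadruple_rotate] at hp
  have := h.2.2.2 e {a, b, c} he (by simpa using And.intro hea (And.intro heb hec)) hp hd
  rwa [show n - e = a + b + c by omega] at this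

end

theorem coprime_of_prime_not_dvd {r a : ℕ} (hr : r.Prime) (h : ¬ r ∣ a) : a.Coprime r :=
  ((hr.coprime_iff_not_dvd).2 h).symm

theorem coprime_four_of_odd {a : ℕ} (h : a % 2 = 1) : a.Coprime 4 := by
  rw [show 4 = 2 ^ 2 by norm_num]
  exact (coprime_of_prime_not_dvd Nat.prime_two (by omega)).pow_right 2

theorem false_of_common_divisor {d a n : ℕ} (hd : 1 < d) (hdn : d ∣ n) (ha : d ∣ a) (ha1 : 0 < a)
    (h : ∀ x, 1 < x → x ≤ a → x ∣ a → ¬ x ∣ n) : False :=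
  h d hd (Nat.le_of_dvd ha1 ha) ha hdn

variable {n : ℕ} {p q : Multiset ℕ → Prop}

/-- In odd degree, a block size is incompatible with prime cycle types. -/
theorem not_hasBlockSize_of_odd (hn : n % 2 = 1) (h9 : 9 ≤ n) (hp : AvoidsPrimeCycle n p)
    (hcov : CoversEvenTypes n p q) (d : ℕ) : ¬ HasBlockSize n q d := by
  intro h
  have h3d := h.three_mul_le hn
  have hd1 := h.1
  have hdn := h.2.2.1
  -- The three types used make `d` divide 8, 6 or 4. The residues of `n` modulo 3 and 5 guarantee
  -- the coprimality conditions, and `d` also divides the odd number `n`, which excludes 2; in the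
  -- case of 6, `n % 3 = 1` excludes 3 as well.
  by_cases h1 : n % 3 = 1
  · by_cases h5 : n % 5 = 1
    · have ht := hp.triple hcov hn 5 3 (n - 8) (by norm_num) (by omega) (by omega) (by omega)
        (by omega) (by omega) (by omega)
      have := h.dvd_of_triple ht (by omega) (by omega) (by omega)
        (coprime_of_prime_not_dvd (by norm_num) (by omega))
        (coprime_of_prime_not_dvd (by norm_num) (by omega))
      refine false_of_common_divisor hd1 hdn this (by omega) fun x hx1 hx2 hx3 => ?_
      interval_cases x <;> omega
    · have ht := hp.triple hcov hn 5 1 (n - 6) (by norm_num) (by omega) (by omega) (by omega)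
        (by omega) (by omega) (by omega)
      have := h.dvd_of_triple ht (by omega) (by omega) (by omega)
        (coprime_of_prime_not_dvd (by norm_num) (by omega)) (Nat.coprime_one_right _)
      refine false_of_common_divisor hd1 hdn this (by omega) fun x hx1 hx2 hx3 => ?_
      interval_cases x <;> omega
  · have ht := hp.triple hcov hn 3 1 (n - 4) (by norm_num) (by omega) (by omega) (by omega)
      (by omega) (by omega) (by omega)
    have := h.dvd_of_triple ht (by omega) (by omega) (by omega)
      (coprime_of_prime_not_dvd (by norm_num) (by omega)) (Nat.coprime_one_right _)
    refine false_of_common_divisor hd1 hdn this (by omega) fun x hx1 hx2 hx3 => ?_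
    interval_cases x <;> omega

/-- Intersecting the subset sums of two or three types with a part 3, 5 or 7 leaves no `k` unless n
= 9. There the types {3, 1, 5}, {3, 2, 4} and {5, 2, 2} have the common sums 4 and 5. -/
theorem eq_nine_of_hasPartialSum (hn : n % 2 = 1) (h9 : 9 ≤ n) (hp : AvoidsPrimeCycle n p)
    (hcov : CoversEvenTypes n p q) {k : ℕ} (hk0 : 0 < k) (hkn : k < n) (hk : HasPartialSum q k) :
    n = 9 ∧ (k = 4 ∨ k = 5) := by
  have hprime : ∀ r b c, r.Prime → 0 < b → 0 < c → 3 ≤ b + c → r + b + c = n → ¬ r ∣ b → ¬ r ∣ c →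
      k = 0 ∨ k = c ∨ k = b ∨ k = b + c ∨ k = r ∨ k = r + c ∨ k = r + b ∨ k = r + b + c :=
    fun r b c h1 h2 h3 h4 h5 h6 h7 => le_triple_sum (hk _ (hp.triple hcov hn r b c h1 h2 h3 h4 h5 h6 h7))
  have h3 := fun b c => hprime 3 b c (by norm_num)
  have h5 := fun b c => hprime 5 b c (by norm_num)
  have h7 := fun b c => hprime 7 b c (by norm_num)
  clear hprime
  have a1 := h3 1 (n - 4)
  have a2 := h3 2 (n - 5)
  have a3 := h3 4 (n - 7)
  have a4 := h3 5 (n - 8)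
  have b1 := h5 1 (n - 6)
  have b2 := h5 2 (n - 7)
  have b3 := h5 3 (n - 8)
  have c1 := h7 1 (n - 8)
  have c2 := h7 2 (n - 9)
  clear h3 h5 h7
  have hmod : n % 3 = 0 ∨ n % 3 = 1 ∨ n % 3 = 2 := by omega
  rcases hmod with h | h | h
  · have a1 := a1 (by omega) (by omega) (by omega) (by omega) (by omega) (by omega)
    have a2 := a2 (by omega) (by omega) (by omega) (by omega) (by omega) (by omega)
    clear a3 a4 b3 c1 c2
    by_cases h5 : n % 5 = 2
    · have b1 := b1 (by omega) (by omega) (by omega) (by omega) (by omega) (by omega)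
      omega
    · have b2 := b2 (by omega) (by omega) (by omega) (by omega) (by omega) (by omega)
      omega
  · have a2 := a2 (by omega) (by omega) (by omega) (by omega) (by omega) (by omega)
    have a4 := a4 (by omega) (by omega) (by omega) (by omega) (by omega) (by omega)
    clear a1 a3 b1 b2 b3
    by_cases h7 : n % 7 = 2
    · have c1 := c1 (by omega) (by omega) (by omega) (by omega) (by omega) (by omega)
      omega
    · have c2 := c2 (by omega) (by omega) (by omega) (by omega) (by omega) (by omega)
      omega
  · have a1 := a1 (by omega) (by omega) (by omega) (by omega) (by omega) (by omega)
    have a3 := a3 (by omega) (by omega) (by omega) (by omega) (by omega) (by omega)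
    clear a2 a4 c1 c2
    by_cases h11 : n = 11
    · have b2 := b2 (by omega) (by omega) (by omega) (by omega) (by omega) (by omega)
      have b3 := b3 (by omega) (by omega) (by omega) (by omega) (by omega) (by omega)
      omega
    · by_cases h5 : n % 5 = 2
      · have b1 := b1 (by omega) (by omega) (by omega) (by omega) (by omega) (by omega)
        omega
      · have b2 := b2 (by omega) (by omega) (by omega) (by omega) (by omega) (by omega)
        omega

/-- The alternatives for the cycle types of a permutation group of degree `n` that does not contain
the alternating group. -/
def TypeTrichotomy (n : ℕ) (p : Multiset ℕ → Prop) : Prop :=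
  (∃ k, 0 < k ∧ k < n ∧ HasPartialSum p k) ∨ (∃ d, HasBlockSize n p d) ∨ AvoidsPrimeCycle n p

/-- A single type with a part 3 and no other multiple of 3 would be missing from both sides. -/
theorem not_avoidsPrimeCycle_of_odd (hn : n % 2 = 1) (h9 : 9 ≤ n) (hp : AvoidsPrimeCycle n p)
    (hcov : CoversEvenTypes n p q) : ¬ AvoidsPrimeCycle n q := by
  intro hq
  by_cases h1 : n % 3 = 1
  · refine hq 3 _ (by norm_num) (by omega) ?_ (hp.triple hcov hn 3 2 (n - 5) (by norm_num)
      (by omega) (by omega) (by omega) (by omega) (by omega) (by omega))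
    have : Nat.Coprime 3 (n - 5) := (Nat.prime_three.coprime_iff_not_dvd).2 (by omega)
    simpa using And.intro (by decide : Odd 3) this
  · refine hq 3 _ (by norm_num) (by omega) ?_ (hp.triple hcov hn 3 1 (n - 4) (by norm_num)
      (by omega) (by omega) (by omega) (by omega) (by omega) (by omega))
    have : Nat.Coprime 3 (n - 4) := (Nat.prime_three.coprime_iff_not_dvd).2 (by omega)
    simpa using this

theorem eq_nine_of_avoidsPrimeCycle (hn : n % 2 = 1) (h9 : 9 ≤ n) (hp : AvoidsPrimeCycle n p)
    (hq : TypeTrichotomy n q) (hcov : CoversEvenTypes n p q) :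
    n = 9 ∧ ∃ k, (k = 4 ∨ k = 5) ∧ HasPartialSum q k := by
  rcases hq with ⟨k, hk0, hkn, hk⟩ | ⟨d, hd⟩ | hq
  · have := eq_nine_of_hasPartialSum hn h9 hp hcov hk0 hkn hk
    exact ⟨this.1, k, this.2, hk⟩
  · exact (not_hasBlockSize_of_odd hn h9 hp hcov d hd).elim
  · exact (not_avoidsPrimeCycle_of_odd hn h9 hp hcov hq).elim

theorem avoidsPrimeCycle_of_odd_of_single (hn : n % 2 = 1) (h9 : 9 ≤ n) (hp : TypeTrichotomy n p)
    (hq : TypeTrichotomy n q) (hcov : CoversEvenTypes n p q) (hpn : p {n}) :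
    AvoidsPrimeCycle n p ∨ AvoidsPrimeCycle n q := by
  -- The cycle of length `n - 2` would make the block size divide 2, although it divides the odd
  -- number `n`.
  have hblock : ∀ r : Multiset ℕ → Prop, ∀ d, HasBlockSize n r d → ¬ r {1, 1, n - 2} := by
    intro r d h ht
    have := h.dvd_of_triple ht (by omega) (by omega) (by have := h.two_mul_le; omega)
      (Nat.coprime_one_right _) (Nat.coprime_one_right _)
    refine false_of_common_divisor h.1 h.2.2.1 this (by omega) fun x hx1 hx2 hx3 => ?_
    interval_cases x
    omega
  rcases hp with ⟨k, hk0, hkn, hk⟩ | ⟨d, hd⟩ | hp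
  · have := le_singleton_sum (hk _ hpn)
    omega
  · rcases hq with ⟨k, hk0, hkn, hk⟩ | ⟨e, he⟩ | hq
    · exfalso
      have h3d := hd.three_mul_le hn
      have hpos : ∀ a, 0 < a → d ∣ a → (∀ x, 1 < x → x ≤ a → x ∣ a → ¬ x ∣ n) → False :=
        fun a ha hda h => false_of_common_divisor hd.1 hd.2.2.1 hda ha h
      have hq1 := (hcov.triple hn 1 1 (n - 2) (by omega) (by omega) (by omega)
        (by omega)).resolve_left (hblock p d hd)
      have hk1 := le_triple_sum (hk _ hq1)
      -- The type {1, 1, n - 2} leaves k = 1, 2, n - 2 or n - 1. In each case a type without subset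
      -- sum `k` has to come from `p`, where it makes `d` divide 4 or 8. Degree 9 is separate
      -- because {4, 4, n - 8} then has no long cycle.
      by_cases hk2 : k = 1 ∨ k = n - 1
      · have ht := (hcov.triple hn 2 2 (n - 4) (by omega) (by omega) (by omega)
          (by omega)).resolve_right fun h => by have := le_triple_sum (hk _ h); omega
        have hc2 : (n - 4).Coprime 2 := coprime_of_prime_not_dvd Nat.prime_two (by omega)
        refine hpos _ (by omega) (hd.dvd_of_triple ht (by omega) (by omega) (by omega) hc2 hc2) ?_
        intro x hx1 hx2 hx3
        interval_cases x <;> omega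
      · by_cases hn9 : n = 9
        · subst hn9
          have ht := (hcov.triple hn 3 1 5 (by omega) (by omega) (by omega)
            (by omega)).resolve_right fun h => by have := le_triple_sum (hk _ h); omega
          refine hpos _ (by omega) (hd.dvd_of_triple ht (by omega) (by omega) (by omega)
            (by norm_num) (by norm_num)) ?_
          intro x hx1 hx2 hx3
          interval_cases x <;> omega
        · have ht := (hcov.triple hn 4 4 (n - 8) (by omega) (by omega) (by omega)
            (by omega)).resolve_right fun h => by have := le_triple_sum (hk _ h); omega
          have hc4 : (n - 8).Coprime 4 := coprime_four_of_odd (by omega)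
          refine hpos _ (by omega) (hd.dvd_of_triple ht (by omega) (by omega) (by omega) hc4 hc4) ?_
          intro x hx1 hx2 hx3
          interval_cases x <;> omega
    · rcases hcov.triple hn 1 1 (n - 2) (by omega) (by omega) (by omega) (by omega) with h | h
      · exact (hblock p d hd h).elim
      · exact (hblock q e he h).elim
    · exact Or.inr hq
  · exact Or.inl hp

/-- The only odd degree at least nine in which two cycle type restrictions are compatible is nine. -/
theorem odd_degree_exception (hn : n % 2 = 1) (h9 : 9 ≤ n) (hp : TypeTrichotomy n p)
    (hq : TypeTrichotomy n q) (hcov : CoversEvenTypes n p q) :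
    n = 9 ∧ ((AvoidsPrimeCycle n p ∧ ∃ k, (k = 4 ∨ k = 5) ∧ HasPartialSum q k) ∨
      (AvoidsPrimeCycle n q ∧ ∃ k, (k = 4 ∨ k = 5) ∧ HasPartialSum p k)) := by
  have : AvoidsPrimeCycle n p ∨ AvoidsPrimeCycle n q := by
    rcases hcov.single hn with h | h
    · exact avoidsPrimeCycle_of_odd_of_single hn h9 hp hq hcov h
    · exact (avoidsPrimeCycle_of_odd_of_single hn h9 hq hp hcov.symm h).symm
  rcases this with h | h
  · have := eq_nine_of_avoidsPrimeCycle hn h9 h hq hcov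
    exact ⟨this.1, Or.inl ⟨h, this.2⟩⟩
  · have := eq_nine_of_avoidsPrimeCycle hn h9 h hp hcov.symm
    exact ⟨this.1, Or.inr ⟨h, this.2⟩⟩

/-- A type {3, n - 3} or {5, n - 5} makes `d` divide 3 or 5 and thus, if that prime does not divide
`n`, equal 1. If 30 divides `n`, the two quadruples make `d` a common divisor of 7 and 9. The bound
`20 ≤ n` in `h9` spares degree 10, where `n - 9` would be a part 1. -/
theorem not_hasBlockSize_of_even (hn : n % 2 = 0) (h10 : 10 ≤ n)
    (h3 : n % 3 ≠ 0 → q {3, n - 3}) (h5 : n % 5 ≠ 0 → q {5, n - 5})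
    (h7 : n % 3 = 0 → q {3, 2, 2, n - 7}) (h9 : n % 5 = 0 → 20 ≤ n → q {5, 2, 2, n - 9}) (d : ℕ) :
    ¬ HasBlockSize n q d := by
  intro h
  have h2d := h.two_mul_le
  by_cases hm3 : n % 3 = 0
  · by_cases hm5 : n % 5 = 0
    · have hc2 : (n - 7).Coprime 2 := coprime_of_prime_not_dvd Nat.prime_two (by omega)
      have hc2' : (n - 9).Coprime 2 := coprime_of_prime_not_dvd Nat.prime_two (by omega)
      have e7 := h.dvd_of_quadruple (h7 hm3) (by omega) (by omega) (by omega)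
        (coprime_of_prime_not_dvd Nat.prime_three (by omega)) hc2 hc2
      have e9 := h.dvd_of_quadruple (h9 hm5 (by omega)) (by omega) (by omega) (by omega)
        (coprime_of_prime_not_dvd Nat.prime_five (by omega)) hc2' hc2'
      refine false_of_common_divisor h.1 e9 e7 (by omega) fun x hx1 hx2 hx3 => ?_
      interval_cases x <;> omega
    · have := h.dvd_of_pair (h5 hm5) (by omega) (by omega) (by omega)
        (coprime_of_prime_not_dvd (by norm_num) (by omega))
      refine false_of_common_divisor h.1 h.2.2.1 this (by omega) fun x hx1 hx2 hx3 => ?_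
      interval_cases x <;> omega
  · have := h.dvd_of_pair (h3 hm3) (by omega) (by omega) (by omega)
      (coprime_of_prime_not_dvd (by norm_num) (by omega))
    refine false_of_common_divisor h.1 h.2.2.1 this (by omega) fun x hx1 hx2 hx3 => ?_
    interval_cases x <;> omega

theorem not_avoidsPrimeCycle_of_even (h10 : 10 ≤ n)
    (h3 : n % 3 ≠ 0 → q {3, n - 3}) (h7 : n % 3 = 0 → q {3, 2, 2, n - 7}) :
    ¬ AvoidsPrimeCycle n q := by
  intro hq
  have hc := fun a ha => (Nat.prime_three.coprime_iff_not_dvd (n := a)).2 ha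
  by_cases hm3 : n % 3 = 0
  · refine hq 3 _ (by norm_num) (by omega) ?_ (h7 hm3)
    simpa using And.intro (by decide : Odd 3) (hc (n - 7) (by omega))
  · refine hq 3 _ (by norm_num) (by omega) ?_ (h3 hm3)
    simpa using hc (n - 3) (by omega)

/-- The sums compatible with a part 3 are confronted with those of a type with a part 5. They agree
only for 10 = 3 + 7 = 5 + 1 + 1 + 3 and for 12 = 5 + 7. -/
theorem eq_ten_or_eq_twelve_of_hasPartialSum (hn : n % 2 = 0) (h10 : 10 ≤ n)
    (hp : AvoidsPrimeCycle n p) (hcov : CoversEvenTypes n p q) {k : ℕ} (hk0 : 0 < k) (hkn : k < n)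
    (hk : HasPartialSum q k) :
    (n = 10 ∧ (k = 3 ∨ k = 7)) ∨ (n = 12 ∧ (k = 5 ∨ k = 7)) := by
  have h2 : ∀ r b, r.Prime → 3 ≤ b → r + b = n → ¬ r ∣ b → k = 0 ∨ k = b ∨ k = r ∨ k = r + b :=
    fun r b h1 h2 h3 h4 => le_pair_sum (hk _ (hp.pair hcov hn r b h1 h2 h3 h4))
  have h4 := fun r b c d (h1 : r.Prime) h2 h3 h4 h5 h6 h7 h8 =>
    le_quadruple_sum (hk _ (hp.quadruple hcov hn r b c d h1 h2 h3 h4 h5 h6 h7 h8))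
  by_cases hm3 : n % 3 = 0
  · have a1 := h4 3 1 1 (n - 5) (by norm_num) (by omega) (by omega) (by omega) (by omega) (by omega)
      (by omega) (by omega)
    have a2 := h4 3 2 2 (n - 7) (by norm_num) (by omega) (by omega) (by omega) (by omega) (by omega)
      (by omega) (by omega)
    -- By complementation one may look at the smaller of `k` and `n - k`: the parts 3, 1, 1 bound it
    -- by 5, and the parts 3, 2, 2 exclude 1.
    have a : ∃ i, 2 ≤ i ∧ i ≤ 5 ∧ (k = i ∨ k = n - i ∨ (n = 12 ∧ k = 7)) := by
      clear h2 h4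
      by_cases hlow : k ≤ 5
      · exact ⟨k, by omega, by omega, by omega⟩
      · exact ⟨n - k, by omega, by omega, by omega⟩
    clear a1 a2
    obtain ⟨i, hi2, hi5, hi⟩ := a
    by_cases hn12 : n = 12
    · subst hn12
      have a3 := h2 5 7 (by norm_num) (by omega) (by omega) (by omega)
      omega
    · have a3 := h4 3 4 4 (n - 11) (by norm_num) (by omega) (by omega) (by omega) (by omega)
        (by omega) (by omega) (by omega)
      have hi34 : i = 3 ∨ i = 4 := by omega
      clear a3
      by_cases hm5 : n % 5 = 0
      · have a4 := h4 5 1 1 (n - 7) (by norm_num) (by omega) (by omega) (by omega) (by omega)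
          (by omega) (by omega) (by omega)
        omega
      · have a4 := h2 5 (n - 5) (by norm_num) (by omega) (by omega) (by omega)
        omega
  · have a1 := h2 3 (n - 3) (by norm_num) (by omega) (by omega) (by omega)
    by_cases hm5 : n % 5 = 0
    · have a4 := h4 5 1 1 (n - 7) (by norm_num) (by omega) (by omega) (by omega) (by omega)
        (by omega) (by omega) (by omega)
      omega
    · have a4 := h2 5 (n - 5) (by norm_num) (by omega) (by omega) (by omega)
      omega

/-- The type {1, n - 1} excludes blocks. If it occurs together with an invariant set, that set or
its complement is a point, so all the test types without a part 1 fall to `q`, which satisfies none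
of its three alternatives. -/
theorem even_degree_exception_of_pair (hn : n % 2 = 0) (h10 : 10 ≤ n) (hp : TypeTrichotomy n p)
    (hq : TypeTrichotomy n q) (hcov : CoversEvenTypes n p q) (hp1 : p {1, n - 1}) :
    AvoidsPrimeCycle n p ∧ ∃ k, HasPartialSum q k ∧
      ((n = 10 ∧ (k = 3 ∨ k = 7)) ∨ (n = 12 ∧ (k = 5 ∨ k = 7))) := by
  rcases hp with ⟨k, hk0, hkn, hk⟩ | ⟨d, hd⟩ | hp
  · exfalso
    have hk1 := le_pair_sum (hk _ hp1)
    have h2 : ∀ a b, 2 ≤ a → 2 ≤ b → a + b = n → q {a, b} := fun a b ha hb hab =>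
      (hcov.pair hn a b (by omega) (by omega) hab).resolve_left fun h => by
        have := le_pair_sum (hk _ h)
        omega
    have h4 : ∀ a b c d, 2 ≤ a → 2 ≤ b → 2 ≤ c → 2 ≤ d → a + b + c + d = n → q {a, b, c, d} :=
      fun a b c d ha hb hc hd hs =>
      (hcov.quadruple hn a b c d (by omega) (by omega) (by omega) (by omega) hs).resolve_left
        fun h => by
          have := le_quadruple_sum (hk _ h)
          omega
    rcases hq with ⟨j, hj0, hjn, hj⟩ | ⟨d, hd⟩ | hq
    · have e2 := le_pair_sum (hj _ (h2 2 (n - 2) (by omega) (by omega) (by omega)))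
      have e3 := le_pair_sum (hj _ (h2 3 (n - 3) (by omega) (by omega) (by omega)))
      omega
    · refine not_hasBlockSize_of_even hn h10 (fun _ => h2 _ _ ?_ ?_ ?_) (fun _ => h2 _ _ ?_ ?_ ?_)
        (fun _ => h4 _ _ _ _ ?_ ?_ ?_ ?_ ?_) (fun _ _ => h4 _ _ _ _ ?_ ?_ ?_ ?_ ?_) d hd <;> omega
    · refine not_avoidsPrimeCycle_of_even h10 (fun _ => h2 _ _ ?_ ?_ ?_)
        (fun _ => h4 _ _ _ _ ?_ ?_ ?_ ?_ ?_) hq <;> omega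
  · have := hd.dvd_of_pair hp1 (by omega) (by omega) (by have := hd.2.1; omega)
      (Nat.coprime_one_right _)
    have := Nat.le_of_dvd one_pos this
    have := hd.1
    omega
  · refine ⟨hp, ?_⟩
    have h3 : n % 3 ≠ 0 → q {3, n - 3} := fun h =>
      hp.pair hcov hn 3 (n - 3) (by norm_num) (by omega) (by omega) (by omega)
    have h7 : n % 3 = 0 → q {3, 2, 2, n - 7} := fun h =>
      hp.quadruple hcov hn 3 2 2 (n - 7) (by norm_num) (by omega) (by omega) (by omega) (by omega)
        (by omega) (by omega) (by omega)
    rcases hq with ⟨k, hk0, hkn, hk⟩ | ⟨d, hd⟩ | hq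
    · exact ⟨k, hk, eq_ten_or_eq_twelve_of_hasPartialSum hn h10 hp hcov hk0 hkn hk⟩
    · refine (not_hasBlockSize_of_even hn h10 h3 (fun h => ?_) h7 (fun h _ => ?_) d hd).elim
      · exact hp.pair hcov hn 5 (n - 5) (by norm_num) (by omega) (by omega) (by omega)
      · exact hp.quadruple hcov hn 5 2 2 (n - 9) (by norm_num) (by omega) (by omega) (by omega)
          (by omega) (by omega) (by omega) (by omega)
    · exact (not_avoidsPrimeCycle_of_even h10 h3 h7 hq).elim

end Arithmetic
-- Three-cycles as commutators, and degree 10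
section SmallSupport

variable {α : Type*}

/-- If two permutations agree on a common invariant set and, outside of it, move only one common
point, then their commutator is a three-cycle. -/
theorem isThreeCycle_commutator [Fintype α] [DecidableEq α] {g h : Equiv.Perm α} {P : Set α} {a : α}
    (ha : a ∉ P)
    (hga : g a ≠ a) (hha : h a ≠ a) (hg : ∀ x, g x ∈ P ↔ x ∈ P) (hh : ∀ x, h x ∈ P ↔ x ∈ P)
    (hP : ∀ x ∈ P, g x = h x) (hx : ∀ x ∉ P, x ≠ a → g x = x ∨ h x = x) :
    IsThreeCycle (g * h * g⁻¹ * h⁻¹) := by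
  have hg' : ∀ x, g⁻¹ x ∈ P ↔ x ∈ P := fun x => by rw [← hg (g⁻¹ x)]; simp
  have hh' : ∀ x, h⁻¹ x ∈ P ↔ x ∈ P := fun x => by rw [← hh (h⁻¹ x)]; simp
  have hgfix : ∀ x, g x = x → g⁻¹ x = x := fun x hx => by rw [inv_eq_iff_eq, hx]
  have hhfix : ∀ x, h x = x → h⁻¹ x = x := fun x hx => by rw [inv_eq_iff_eq, hx]
  have movg : ∀ x, x ∉ P → x ≠ a → g x ≠ x → h x = x := fun x h1 h2 h3 => (hx x h1 h2).resolve_left h3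
  have movh : ∀ x, x ∉ P → x ≠ a → h x ≠ x → g x = x := fun x h1 h2 h3 => (hx x h1 h2).resolve_right h3
  have gb : h (g a) = g a := movg _ (by rwa [hg]) hga fun h' => hga (g.injective h')
  have hc : g (h a) = h a := movh _ (by rwa [hh]) hha fun h' => hha (h.injective h')
  have gi : h (g⁻¹ a) = g⁻¹ a := by
    refine movg _ (by rwa [hg']) (fun h' => hga ?_) fun h' => hga ?_
    · rw [inv_eq_iff_eq] at h'; exact h'.symm
    · have : a = g⁻¹ a := by simpa using h'
      rw [eq_comm, inv_eq_iff_eq] at this; exact this.symm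
  have hi : g (h⁻¹ a) = h⁻¹ a := by
    refine movh _ (by rwa [hh']) (fun h' => hha ?_) fun h' => hha ?_
    · rw [inv_eq_iff_eq] at h'; exact h'.symm
    · have : a = h⁻¹ a := by simpa using h'
      rw [eq_comm, inv_eq_iff_eq] at this; exact this.symm
  have hbc : g a ≠ h a := fun h' => by
    rw [h'] at gb
    exact hha (h.injective gb)
  -- Since `g a` is fixed by `h` and `h a` by `g`, the commutator sends `a` to `g a`, `g a` to `h a`
  -- and `h a` to `a`. On `P` the two permutations agree and cancel; elsewhere at most one of them
  -- acts.
  have heq : g * h * g⁻¹ * h⁻¹ = Equiv.swap (g a) a * Equiv.swap (g a) (h a) := by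
    ext x
    simp only [mul_apply]
    by_cases h1 : x = a
    · subst h1
      rw [hgfix _ hi, ← mul_apply h, mul_inv_cancel, one_apply,
        Equiv.swap_apply_of_ne_of_ne hga.symm hha.symm, Equiv.swap_apply_right]
    by_cases h2 : x = g a
    · subst h2
      rw [hhfix _ gb, ← mul_apply g⁻¹ g, inv_mul_cancel, one_apply, hc, Equiv.swap_apply_left,
        Equiv.swap_apply_of_ne_of_ne hbc.symm hha]
    by_cases h3 : x = h a
    · subst h3
      rw [← mul_apply h⁻¹ h, inv_mul_cancel, one_apply, gi, ← mul_apply, mul_inv_cancel, one_apply,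
        Equiv.swap_apply_right, Equiv.swap_apply_left]
    rw [Equiv.swap_apply_of_ne_of_ne h2 h3, Equiv.swap_apply_of_ne_of_ne h2 h1]
    by_cases hxP : x ∈ P
    · have h4 : g⁻¹ (h⁻¹ x) ∈ P := by rwa [hg', hh']
      rw [← hP _ h4]
      have h5 : g (h⁻¹ x) = x := by rw [hP _ (by rwa [hh'])]; simp
      rw [← mul_apply g g⁻¹, mul_inv_cancel, one_apply, h5]
    · by_cases hxh : h x = x
      · rw [hhfix x hxh]
        by_cases hxg : g x = x
        · rw [hgfix x hxg, hxh, hxg]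
        · have : h (g⁻¹ x) = g⁻¹ x := by
            refine movg _ (by rwa [hg']) (fun h' => h2 ?_) fun h' => hxg ?_
            · rw [inv_eq_iff_eq] at h'; exact h'
            · have : x = g⁻¹ x := by simpa using h'
              rw [eq_comm, inv_eq_iff_eq] at this; exact this.symm
          rw [this]; simp
      · have : g (h⁻¹ x) = h⁻¹ x := by
          refine movh _ (by rwa [hh']) (fun h' => h3 ?_) fun h' => hxh ?_
          · rw [inv_eq_iff_eq] at h'; exact h'
          · have : x = h⁻¹ x := by simpa using h'
            rw [eq_comm, inv_eq_iff_eq] at this; exact this.symm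
        rw [hgfix _ this, ← mul_apply h, mul_inv_cancel, one_apply, movh x hxP h1 hxh]
  rw [heq]
  exact isThreeCycle_swap_mul_swap_same hga hbc hha.symm

variable [Fintype α] [DecidableEq α]

/-- Pigeonhole: an exponent `t` strictly between 0 and the length of `c` that fails sends some `s`
in `S` to another point of `S`, and the pair of these points determines `t`. There are fewer such
pairs than exponents. -/
theorem exists_pow_forall_notMem {c : Equiv.Perm α} (hc : c.IsCycle) {S : Finset α}
    (hS : S ⊆ c.support) (hcard : S.offDiag.card + 1 < c.support.card) :
    ∃ t : ℕ, ∀ s ∈ S, (c ^ t) s ∉ S := by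
  by_contra! h
  choose f hf hf' using h
  obtain ⟨t, ht, t', ht', hne, heq⟩ := Finset.exists_ne_map_eq_of_card_lt_of_maps_to
    (s := Finset.Ioo 0 c.support.card) (t := S.offDiag) (f := fun t => (f t, (c ^ t) (f t)))
    (by rw [Nat.card_Ioo]; omega)
    (by
      intro t ht
      rw [Finset.mem_coe, Finset.mem_Ioo] at ht
      rw [Finset.mem_coe, Finset.mem_offDiag]
      refine ⟨hf t, hf' t, fun h => ?_⟩
      have := (hc.pow_eq_one_iff' (n := t) (mem_support.1 (hS (hf t)))).2 h.symm
      rw [← orderOf_dvd_iff_pow_eq_one, hc.orderOf] at this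
      have := Nat.le_of_dvd ht.1 this
      omega)
  rw [Prod.mk.injEq] at heq
  rw [Finset.mem_Ioo] at ht ht'
  have hpow : c ^ t = c ^ t' :=
    hc.pow_eq_pow_iff.2 ⟨f t, mem_support.1 (hS (hf t)), by rw [heq.2, heq.1]⟩
  rw [pow_inj_mod, hc.orderOf, Nat.mod_eq_of_lt ht.2, Nat.mod_eq_of_lt ht'.2] at hpow
  exact hne hpow

/-- If the other cycle lengths divide `m`, then the `m`-th power is a power of a single cycle. -/
theorem exists_pow_isCycle_mem {H : Subgroup (Equiv.Perm α)} {q : ℕ} {s : Multiset ℕ} (hq : 2 ≤ q)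
    (hH : HasType H (q ::ₘ s)) (m : ℕ) (hm : ∀ x ∈ s, x ∣ m) :
    ∃ c : Equiv.Perm α, c.IsCycle ∧ c.support.card = q ∧ c ^ m ∈ H := by
  obtain ⟨σ, hσH, hσ⟩ := hH
  obtain ⟨c, τ, hdis, rfl, hc, hcq, hτ⟩ := exists_cycle_factor hq hσ
  refine ⟨c, hc, hcq, ?_⟩
  have h1 : τ ^ m = 1 := by
    rw [← orderOf_dvd_iff_pow_eq_one, ← lcm_cycleType, hτ, Multiset.lcm_dvd]
    exact fun x hx => hm x (Multiset.mem_of_mem_filter hx)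
  have := H.pow_mem hσH m
  rwa [hdis.commute.mul_pow, h1, one_mul] at this

/-- Conjugate `g` so that it moves the fixed point `a` of `c`. A suitable power of `c` translates
the other moved points off themselves, so the conjugate of `g` by it shares with `g` only the moved
point `a`, and their commutator is a three-cycle. -/
theorem exists_isThreeCycle_mem_of_isCycle {K : Subgroup (Equiv.Perm α)} (hK : IsPretransitive K α)
    {c g : Equiv.Perm α} (hcK : c ∈ K) (hc : c.IsCycle)
    (hcard : c.support.card + 1 = Fintype.card α) (hgK : g ∈ K) (hg1 : g ≠ 1)
    (hg : (g.support.card - 1) * (g.support.card - 2) + 1 < c.support.card) :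
    ∃ k ∈ K, IsThreeCycle k := by
  obtain ⟨a, ha⟩ : ∃ a, a ∉ c.support := by
    by_contra! h
    have := Finset.card_eq_iff_eq_univ c.support |>.2 (Finset.eq_univ_iff_forall.2 h)
    omega
  obtain ⟨b, hb⟩ : ∃ b, g b ≠ b := by
    by_contra! h
    exact hg1 (Equiv.ext h)
  obtain ⟨⟨k, hkK⟩, hk⟩ := hK.exists_smul_eq b a
  change k b = a at hk
  set g₁ := k * g * k⁻¹ with hg₁
  have hg₁K : g₁ ∈ K := K.mul_mem (K.mul_mem hkK hgK) (K.inv_mem hkK)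
  have hga : a ∈ g₁.support := by
    rw [mem_support, hg₁, ← hk]
    simpa using hb
  have hs : g₁.support.card = g.support.card := by rw [hg₁, card_support_conj]
  have hcomp : ∀ x, x ≠ a → x ∈ c.support := by
    intro x hx
    have h1 : c.supportᶜ.card = 1 := by rw [Finset.card_compl]; omega
    obtain ⟨y, hy⟩ := Finset.card_eq_one.1 h1
    by_contra hxc
    have hx' : x ∈ c.supportᶜ := Finset.mem_compl.2 hxc
    have ha' : a ∈ c.supportᶜ := Finset.mem_compl.2 ha
    rw [hy, Finset.mem_singleton] at hx' ha'
    exact hx (hx'.trans ha'.symm)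
  obtain ⟨t, ht⟩ := exists_pow_forall_notMem hc (S := g₁.support.erase a)
    (fun x hx => hcomp x (Finset.ne_of_mem_erase hx)) (by
      rw [Finset.offDiag_card, Finset.card_erase_of_mem hga, hs, ← Nat.mul_sub_one,
        Nat.sub_sub]
      exact hg)
  have hca : (c ^ t) a = a := pow_apply_eq_self_of_apply_eq_self (notMem_support.1 ha) t
  have hca' : (c ^ t)⁻¹ a = a := by rw [inv_eq_iff_eq, hca]
  refine ⟨_, ?_, isThreeCycle_commutator (g := g₁) (h := c ^ t * g₁ * (c ^ t)⁻¹) (P := ∅) (a := a)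
    (by simp) (mem_support.1 hga) ?_ (by simp) (by simp) (by simp) ?_⟩
  · have h1 := K.mul_mem (K.mul_mem (K.pow_mem hcK t) hg₁K) (K.inv_mem (K.pow_mem hcK t))
    exact K.mul_mem (K.mul_mem (K.mul_mem hg₁K h1) (K.inv_mem hg₁K)) (K.inv_mem h1)
  · simp only [mul_apply]
    rw [hca']
    intro h
    exact mem_support.1 hga ((c ^ t).injective (h.trans hca.symm))
  · intro x _ hxa
    by_contra! hx
    have h1 : (c ^ t)⁻¹ x ∈ g₁.support.erase a := by
      rw [Finset.mem_erase, mem_support]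
      refine ⟨fun h => hxa ?_, fun h => hx.2 ?_⟩
      · rw [inv_eq_iff_eq, hca] at h; exact h
      · simp only [mul_apply]; rw [h]; simp
    refine ht _ h1 ?_
    rw [← mul_apply, mul_inv_cancel, one_apply, Finset.mem_erase, mem_support]
    exact ⟨hxa, hx.1⟩

theorem hasType_replicate_of_isThreeCycle {K : Subgroup (Equiv.Perm α)} {k : Equiv.Perm α}
    (hk : k ∈ K) (h3 : IsThreeCycle k) :
    HasType K (3 ::ₘ Multiset.replicate (Fintype.card α - 3) 1) := by
  refine ⟨k, hk, ?_⟩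
  rw [parts_partition, h3.cycleType, h3.card_support, Multiset.singleton_add]

theorem not_isThreeCycle_of_avoidsPrimeCycle {K : Subgroup (Equiv.Perm α)}
    (hα : 6 ≤ Fintype.card α) (hK : AvoidsPrimeCycle (Fintype.card α) (HasType K))
    {k : Equiv.Perm α} (hk : k ∈ K) : ¬ IsThreeCycle k := fun h3 =>
  hK 3 _ Nat.prime_three hα
    (fun x hx => by rw [Multiset.eq_of_mem_replicate hx]; exact Nat.coprime_one_right _)
    (hasType_replicate_of_isThreeCycle hk h3)

theorem isPretransitive_of_hasType_pair {K : Subgroup (Equiv.Perm α)} {a b c d : ℕ}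
    (h1 : HasType K {a, b}) (h2 : HasType K {c, d}) (hab : a + b = Fintype.card α)
    (hbc : b ≠ c) (hbd : b ≠ d) : IsPretransitive K α := by
  by_contra h
  obtain ⟨k, hk0, hkn, hk⟩ := exists_card_of_not_isPretransitive h
  have e1 := le_pair_sum (hk _ h1)
  have e2 := le_pair_sum (hk _ h2)
  obtain ⟨σ, -, hσ⟩ := h2
  have := σ.partition.parts_sum
  rw [hσ] at this
  simp at this
  omega

/-- The sixth power of an element of type {4, 6} is the square of its four-cycle and moves four
points. The numerical condition beside the nine-cycle becomes 3 · 2 + 1 < 9. -/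
theorem degree_ten_contradiction {K : Subgroup (Equiv.Perm (Fin 10))} (hK : AvoidsPrimeCycle 10 (HasType K))
    (h9 : HasType K {1, 9}) (h5 : HasType K {5, 5}) (h6 : HasType K {4, 6}) : False := by
  have htr := isPretransitive_of_hasType_pair h9 h5 (by simp) (by norm_num) (by norm_num)
  rw [Multiset.pair_comm] at h9
  obtain ⟨c, hcK, hc, hc9⟩ := exists_isCycle_mem_of_hasType (q := 9) (s := {1}) (by norm_num)
    (by simp) h9
  obtain ⟨z, hz, hz4, hzK⟩ := exists_pow_isCycle_mem (q := 4) (s := {6}) (by norm_num) h6 6 (by simp)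
  have hzo : orderOf z = 4 := by rw [hz.orderOf, hz4]
  have hz2 : z ^ 6 = z ^ 2 := by rw [← pow_mod_orderOf, hzo]
  have hsup : (z ^ 6).support.card = 4 := by
    rw [hz2, hz.support_pow_of_pos_of_lt_orderOf (by norm_num) (by rw [hzo]; norm_num), hz4]
  obtain ⟨k, hk, hk3⟩ := exists_isThreeCycle_mem_of_isCycle htr hcK hc (by rw [hc9]; simp) hzK
    (by intro h; rw [h] at hsup; simp at hsup) (by rw [hsup, hc9]; norm_num)
  exact not_isThreeCycle_of_avoidsPrimeCycle (by simp) (by simpa using hK) hk hk3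

end SmallSupport
-- Degree 12: producing a three-cycle from a nine-cycle
section DegreeTwelve

/-- A set of three residues containing 0, unless it is the subgroup of order 3, has a difference `t`
represented exactly once; translation by `t` then makes it meet itself in the single point `m`. -/
theorem zmod_nine_difference : ∀ i j : ZMod 9, i ≠ 0 → j ≠ 0 → i ≠ j →
    (({0, i, j} : Finset (ZMod 9)) = {0, 3, 6}) ∨ ∃ t m : ZMod 9, m ∈ ({0, i, j} : Finset (ZMod 9)) ∧
      m - t ∈ ({0, i, j} : Finset (ZMod 9)) ∧
      ∀ n ∈ ({0, i, j} : Finset (ZMod 9)), n - t ∈ ({0, i, j} : Finset (ZMod 9)) → n = m := by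
  decide

variable {α : Type*} [Fintype α] [DecidableEq α] {K : Subgroup (Equiv.Perm α)}
  {x : Equiv.Perm α} {q : α}

theorem isCycle_pow_val_add {x : Equiv.Perm α} (hx : x.IsCycle) (hx9 : x.support.card = 9) (n t : ZMod 9)
    (q : α) : (x ^ t.val) ((x ^ n.val) q) = (x ^ (n + t).val) q := by
  rw [← mul_apply, ← pow_add, ZMod.val_add, add_comm t.val]
  congr 1
  rw [← pow_mod_orderOf, hx.orderOf, hx9]

theorem isCycle_pow_val_injective (hx : x.IsCycle) (hx9 : x.support.card = 9) (hq : x q ≠ q) :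
    Function.Injective fun n : ZMod 9 => (x ^ n.val) q := by
  intro n m h
  have h1 : x ^ n.val = x ^ m.val := hx.pow_eq_pow_iff.2 ⟨q, hq, h⟩
  rw [pow_inj_mod, hx.orderOf, hx9, Nat.mod_eq_of_lt (ZMod.val_lt n),
    Nat.mod_eq_of_lt (ZMod.val_lt m)] at h1
  exact ZMod.val_injective 9 h1

theorem isCycle_exists_pow_val_eq (hx : x.IsCycle) (hx9 : x.support.card = 9) (hq : x q ≠ q) {y : α}
    (hy : x y ≠ y) : ∃ n : ZMod 9, (x ^ n.val) q = y := by
  obtain ⟨i, hi⟩ := hx.exists_pow_eq hq hy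
  refine ⟨(i : ZMod 9), ?_⟩
  rw [ZMod.val_natCast, ← hi]
  congr 1
  conv_rhs => rw [← pow_mod_orderOf, hx.orderOf, hx9]

theorem pow_mem_support_compl_iff (k : ℕ) (y : α) : (x ^ k) y ∈ x.supportᶜ ↔ y ∈ x.supportᶜ := by
  rw [Finset.mem_compl, Finset.mem_compl, pow_apply_mem_support]

/-- If a translate of the moved points meets them in a single point, then there is a three-cycle. -/
theorem exists_isThreeCycle_of_translate (hxK : x ∈ K) (hx : x.IsCycle) (hx9 : x.support.card = 9)
    (hq : x q ≠ q) {g : Equiv.Perm α} (hgK : g ∈ K)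
    (hg : ∀ y, g y ∈ x.supportᶜ ↔ y ∈ x.supportᶜ) {t m : ZMod 9}
    (hm : g ((x ^ m.val) q) ≠ (x ^ m.val) q) (hmt : g ((x ^ (m - t).val) q) ≠ (x ^ (m - t).val) q)
    (huniq : ∀ n : ZMod 9, g ((x ^ n.val) q) ≠ (x ^ n.val) q →
      g ((x ^ (n - t).val) q) ≠ (x ^ (n - t).val) q → n = m) :
    ∃ k ∈ K, IsThreeCycle k := by
  set X := x ^ t.val with hX
  have hXK : X ∈ K := K.pow_mem hxK _
  have hXf : ∀ n : ZMod 9, X⁻¹ ((x ^ n.val) q) = (x ^ (n - t).val) q := fun n => by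
    rw [inv_eq_iff_eq, hX, isCycle_pow_val_add hx hx9, sub_add_cancel]
  have hXP : ∀ y ∈ x.supportᶜ, X y = y := fun y hy =>
    pow_apply_eq_self_of_apply_eq_self (notMem_support.1 (Finset.mem_compl.1 hy)) _
  have hXP' : ∀ y ∈ x.supportᶜ, X⁻¹ y = y := fun y hy => by rw [inv_eq_iff_eq, hXP y hy]
  have hXiff : ∀ y, X⁻¹ y ∈ x.supportᶜ ↔ y ∈ x.supportᶜ := fun y => by
    rw [← pow_mem_support_compl_iff t.val (X⁻¹ y), ← hX]; simp
  refine ⟨_, ?_, isThreeCycle_commutator (g := g) (h := X * g * X⁻¹)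
    (P := ((x.supportᶜ : Finset α) : Set α)) (a := (x ^ m.val) q) ?_ hm ?_ hg ?_ ?_ ?_⟩
  · have h1 := K.mul_mem (K.mul_mem hXK hgK) (K.inv_mem hXK)
    exact K.mul_mem (K.mul_mem (K.mul_mem hgK h1) (K.inv_mem hgK)) (K.inv_mem h1)
  · rw [Finset.mem_coe, pow_mem_support_compl_iff]
    simpa using hq
  · simp only [mul_apply]
    intro h
    have : g (X⁻¹ ((x ^ m.val) q)) = X⁻¹ ((x ^ m.val) q) := by
      rw [eq_comm, inv_eq_iff_eq, h]
    rw [hXf] at this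
    exact hmt this
  · intro y
    simp only [mul_apply, Finset.mem_coe]
    rw [hX, pow_mem_support_compl_iff, hg, ← hX, hXiff]
  · intro y hy
    simp only [mul_apply]
    rw [hXP' y hy, hXP _ ((hg y).2 hy)]
  · intro y hy hya
    by_contra! h
    have hy' : x y ≠ y := by simpa using hy
    obtain ⟨n, rfl⟩ := isCycle_exists_pow_val_eq hx hx9 hq hy'
    have := huniq n h.1 fun h' => h.2 (by
      simp only [mul_apply]
      rw [hXf, h', ← hXf]
      simp)
    exact hya (by rw [this])

/-- The nine-cycle identifies its support with the residues modulo 9, `q` being 0. The three points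
moved by `g` there either have a difference occurring once, giving a three-cycle, or form the
subgroup {0, 3, 6}. -/
theorem exists_isThreeCycle_or_coset (hxK : x ∈ K) (hx : x.IsCycle) (hx9 : x.support.card = 9)
    (hq : x q ≠ q) {g : Equiv.Perm α} (hgK : g ∈ K)
    (hg : ∀ y, g y ∈ x.supportᶜ ↔ y ∈ x.supportᶜ) (hcard : (g.support \ x.supportᶜ).card = 3)
    (hgq : g q ≠ q) : (∃ k ∈ K, IsThreeCycle k) ∨
      ∀ n : ZMod 9, g ((x ^ n.val) q) ≠ (x ^ n.val) q ↔ n ∈ ({0, 3, 6} : Finset (ZMod 9)) := by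
  let s : Finset (ZMod 9) := Finset.univ.filter fun n => g ((x ^ n.val) q) ≠ (x ^ n.val) q
  have hs : ∀ n, n ∈ s ↔ g ((x ^ n.val) q) ≠ (x ^ n.val) q := fun n => by simp [s]
  have himg : s.image (fun n : ZMod 9 => (x ^ n.val) q) = g.support \ x.supportᶜ := by
    ext y
    rw [Finset.mem_image, Finset.mem_sdiff, Finset.mem_compl, not_not, mem_support, mem_support]
    constructor
    · rintro ⟨n, hn, rfl⟩
      refine ⟨(hs n).1 hn, ?_⟩
      rw [← mem_support, pow_apply_mem_support, mem_support]
      exact hq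
    · rintro ⟨h1, h2⟩
      obtain ⟨n, rfl⟩ := isCycle_exists_pow_val_eq hx hx9 hq h2
      exact ⟨n, (hs n).2 h1, rfl⟩
  have hs3 : s.card = 3 := by
    rw [← hcard, ← himg, Finset.card_image_of_injective _ (isCycle_pow_val_injective hx hx9 hq)]
  have h0 : (0 : ZMod 9) ∈ s := by rw [hs]; simpa using hgq
  obtain ⟨i, j, hij, hsij⟩ := Finset.card_eq_two.1
    (show (s.erase 0).card = 2 by rw [Finset.card_erase_of_mem h0, hs3])
  have hs0 : s = {0, i, j} := by rw [← Finset.insert_erase h0, hsij]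
  have hi : i ∈ s.erase 0 := by rw [hsij]; simp
  have hj : j ∈ s.erase 0 := by rw [hsij]; simp
  rcases zmod_nine_difference i j (Finset.ne_of_mem_erase hi) (Finset.ne_of_mem_erase hj) hij with
    h | ⟨t, m, h1, h2, h3⟩
  · right
    intro n
    rw [← hs, hs0, h]
  · left
    rw [← hs0] at h1 h2 h3
    exact exists_isThreeCycle_of_translate hxK hx hx9 hq hgK hg ((hs m).1 h1) ((hs _).1 h2)
      fun n hn hn' => h3 n ((hs n).2 hn) ((hs _).2 hn')

/-- The previous dichotomy is applied to `g` and to its conjugate by `h`. If both move the same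
coset, then `h`, which fixes `q`, permutes the two remaining points of the coset, contradicting that
its square fixes neither. -/
theorem exists_isThreeCycle_of_nine_cycle (hxK : x ∈ K) (hx : x.IsCycle) (hx9 : x.support.card = 9)
    (hq : x q ≠ q) {g h : Equiv.Perm α} (hgK : g ∈ K)
    (hg : ∀ y, g y ∈ x.supportᶜ ↔ y ∈ x.supportᶜ) (hcard : (g.support \ x.supportᶜ).card = 3)
    (hgq : g q ≠ q) (hhK : h ∈ K) (hhP : ∀ y ∈ x.supportᶜ, h y = y) (hhq : h q = q)
    (hmov : ∀ y ∈ x.support, y ≠ q → h (h y) ≠ y) : ∃ k ∈ K, IsThreeCycle k := by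
  rcases exists_isThreeCycle_or_coset hxK hx hx9 hq hgK hg hcard hgq with h1 | h1
  · exact h1
  have hhP' : ∀ y ∈ x.supportᶜ, h⁻¹ y = y := fun y hy => by rw [inv_eq_iff_eq, hhP y hy]
  have hhiff : ∀ y, h y ∈ x.supportᶜ ↔ y ∈ x.supportᶜ := fun y =>
    ⟨fun hy => by rwa [← h.injective (hhP _ hy)], fun hy => by rwa [hhP y hy]⟩
  have hhiff' : ∀ y, h⁻¹ y ∈ x.supportᶜ ↔ y ∈ x.supportᶜ := fun y => by
    rw [← hhiff (h⁻¹ y)]; simp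
  have hhq' : h⁻¹ q = q := by rw [inv_eq_iff_eq, hhq]
  rcases exists_isThreeCycle_or_coset hxK hx hx9 hq (g := h * g * h⁻¹)
    (K.mul_mem (K.mul_mem hhK hgK) (K.inv_mem hhK))
    (fun y => by simp only [mul_apply]; rw [hhiff, hg, hhiff'])
    (by
      rw [← hcard]
      apply Finset.card_bij (fun y _ => h⁻¹ y)
      · intro y hy
        rw [Finset.mem_sdiff, mem_support] at hy ⊢
        refine ⟨fun h' => hy.1 ?_, by rw [hhiff']; exact hy.2⟩
        simp only [mul_apply]; rw [h']; simp
      · intro _ _ _ _ h'; exact h⁻¹.injective h'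
      · intro y hy
        rw [Finset.mem_sdiff, mem_support] at hy
        refine ⟨h y, ?_, by simp⟩
        rw [Finset.mem_sdiff, mem_support]
        exact ⟨by simpa using hy.1, by rw [hhiff]; exact hy.2⟩)
    (by
      simp only [mul_apply]
      rw [hhq']
      intro h'
      exact hgq (h.injective (h'.trans hhq.symm))) with h2 | h2
  · exact h2
  exfalso
  have hinj := isCycle_pow_val_injective hx hx9 hq
  have hmemx : ∀ n : ZMod 9, (x ^ n.val) q ∈ x.support := fun n => by
    rw [pow_apply_mem_support, mem_support]; exact hq
  have key : ∀ n : ZMod 9, n ∈ ({0, 3, 6} : Finset (ZMod 9)) → n ≠ 0 →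
      ∃ m ∈ ({0, 3, 6} : Finset (ZMod 9)), m ≠ 0 ∧ m ≠ n ∧
        h ((x ^ m.val) q) = (x ^ n.val) q := by
    intro n hn hn0
    have h3 := (h2 n).2 hn
    have h4 : h⁻¹ ((x ^ n.val) q) ∉ x.supportᶜ := by
      rw [hhiff', Finset.mem_compl, not_not]; exact hmemx n
    obtain ⟨m, hm⟩ := isCycle_exists_pow_val_eq hx hx9 hq
      (mem_support.1 (by simpa using h4) : x (h⁻¹ ((x ^ n.val) q)) ≠ _)
    have hnq : (x ^ n.val) q ≠ q := fun h' => hn0 (hinj (by simpa using h'))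
    refine ⟨m, (h1 m).1 ?_, ?_, ?_, by rw [hm]; simp⟩
    · rw [hm]
      intro h'
      apply h3
      simp only [mul_apply]; rw [h']; simp
    · rintro rfl
      have : q = h⁻¹ ((x ^ n.val) q) := by simpa using hm
      rw [eq_comm, inv_eq_iff_eq, hhq] at this
      exact hnq this
    · rintro rfl
      rw [eq_comm, inv_eq_iff_eq] at hm
      exact hmov _ (hmemx m) hnq (by rw [← hm, ← hm])
  obtain ⟨m, hm, hm0, hm3, e1⟩ := key 3 (by decide) (by decide)
  obtain ⟨l, hl, hl0, hl6, e2⟩ := key 6 (by decide) (by decide)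
  have hm6 : m = 6 := by clear e1; revert hm hm0 hm3; revert m; decide
  have hl3 : l = 3 := by clear e2; revert hl hl0 hl6; revert l; decide
  subst hm6 hl3
  refine hmov _ (hmemx 3) (fun h' => ?_) (by rw [e2, e1])
  have : (3 : ZMod 9) = 0 := hinj (by simpa using h')
  exact absurd this (by decide)

/-- Two-fold transitivity: `z` makes the stabilizer of its only fixed point `e` transitive on all
the other points. -/
theorem exists_mem_map_pair_eq (hK : IsPretransitive K α) {z : Equiv.Perm α} (hzK : z ∈ K)
    (hz : z.IsCycle) (hcard : z.support.card + 1 = Fintype.card α) {a b a' b' : α} (hab : a ≠ b)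
    (hab' : a' ≠ b') : ∃ k ∈ K, k a = a' ∧ k b = b' := by
  obtain ⟨e, he⟩ := Finset.card_eq_one.1
    (show z.supportᶜ.card = 1 by rw [Finset.card_compl]; omega)
  have hze : z e = e := notMem_support.1 (Finset.mem_compl.1 (by rw [he]; simp))
  have hmem : ∀ y, y ≠ e → z y ≠ y := by
    intro y hy h
    have : y ∈ z.supportᶜ := Finset.mem_compl.2 (notMem_support.2 h)
    rw [he, Finset.mem_singleton] at this
    exact hy this
  obtain ⟨⟨k, hkK⟩, hk⟩ := hK.exists_smul_eq a e
  obtain ⟨⟨l, hlK⟩, hl⟩ := hK.exists_smul_eq a' e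
  change k a = e at hk
  change l a' = e at hl
  obtain ⟨i, hi⟩ := hz.exists_zpow_eq (hmem (k b) fun h => hab (k.injective (hk.trans h.symm)))
    (hmem (l b') fun h => hab' (l.injective (hl.trans h.symm)))
  refine ⟨l⁻¹ * z ^ i * k, K.mul_mem (K.mul_mem (K.inv_mem hlK) (K.zpow_mem hzK i)) hkK, ?_, ?_⟩
  · simp only [mul_apply]
    rw [hk, zpow_apply_eq_self_of_apply_eq_self hze, inv_eq_iff_eq, hl]
  · simp only [mul_apply]
    rw [hi, inv_eq_iff_eq]

/-- Three-fold transitivity from a cycle with three fixed points and an element with two. -/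
theorem exists_mem_map_triple_eq
    (h2 : ∀ a b a' b' : α, a ≠ b → a' ≠ b' → ∃ k ∈ K, k a = a' ∧ k b = b') (hxK : x ∈ K)
    (hx : x.IsCycle) {p₁ p₂ p₃ : α} (h12 : p₁ ≠ p₂) (h13 : p₁ ≠ p₃) (h23 : p₂ ≠ p₃)
    (hP : x.supportᶜ = {p₁, p₂, p₃}) {w : Equiv.Perm α} (hwK : w ∈ K)
    (hw : w.supportᶜ.card = 2) {a b c : α} (hab : a ≠ b) (hac : a ≠ c) (hbc : b ≠ c) :
    ∃ k ∈ K, k a = p₁ ∧ k b = p₂ ∧ k c = p₃ := by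
  have hfix : ∀ y, y = p₁ ∨ y = p₂ ∨ y = p₃ ↔ x y = y := fun y => by
    rw [← notMem_support, ← Finset.mem_compl, hP]; simp
  obtain ⟨k, hkK, hka, hkb⟩ := h2 a b p₁ p₂ hab h12
  obtain ⟨u, v, huv, hw'⟩ := Finset.card_eq_two.1 hw
  have hwfix : ∀ y, w y = y ↔ y = u ∨ y = v := fun y => by
    rw [← notMem_support, ← Finset.mem_compl, hw']; simp
  obtain ⟨l, hlK, hl1, hl2⟩ := h2 p₁ p₂ u v h12 huv
  by_cases hc3 : k c = p₃
  · exact ⟨k, hkK, hka, hkb, hc3⟩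
  have hkc : x (k c) ≠ k c := by
    rw [ne_eq, ← hfix, ← hka, ← hkb, k.injective.eq_iff, k.injective.eq_iff]
    rintro (h | h | h)
    · exact hac h.symm
    · exact hbc h.symm
    · exact hc3 h
  -- The conjugate `w'` fixes exactly `p₁` and `p₂`, so it sends `p₃` into the cycle of `x`. A power
  -- of `x` carries `k c` to `w' p₃`, and `w'⁻¹` brings it to `p₃`, with `p₁` and `p₂` fixed
  -- throughout.
  set w' := l⁻¹ * w * l with hw'def
  have hw'K : w' ∈ K := K.mul_mem (K.mul_mem (K.inv_mem hlK) hwK) hlK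
  have hw'fix : ∀ y, w' y = y ↔ y = p₁ ∨ y = p₂ := fun y => by
    rw [hw'def]
    simp only [mul_apply]
    rw [inv_eq_iff_eq, hwfix, ← hl1, ← hl2, l.injective.eq_iff, l.injective.eq_iff]
  have e1 : w' p₁ = p₁ := (hw'fix _).2 (Or.inl rfl)
  have e2 : w' p₂ = p₂ := (hw'fix _).2 (Or.inr rfl)
  have hw3 : x (w' p₃) ≠ w' p₃ := by
    rw [ne_eq, ← hfix]
    rintro (h | h | h)
    · exact h13 (w'.injective (e1.trans h.symm))
    · exact h23 (w'.injective (e2.trans h.symm))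
    · rcases (hw'fix _).1 h with h | h
      · exact h13 h.symm
      · exact h23 h.symm
  obtain ⟨i, hi⟩ := hx.exists_zpow_eq hkc hw3
  refine ⟨w'⁻¹ * x ^ i * k, K.mul_mem (K.mul_mem (K.inv_mem hw'K) (K.zpow_mem hxK i)) hkK, ?_, ?_, ?_⟩
  · simp only [mul_apply]
    rw [hka, zpow_apply_eq_self_of_apply_eq_self ((hfix _).1 (Or.inl rfl)), inv_eq_iff_eq, e1]
  · simp only [mul_apply]
    rw [hkb, zpow_apply_eq_self_of_apply_eq_self ((hfix _).1 (Or.inr (Or.inl rfl))), inv_eq_iff_eq, e2]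
  · simp only [mul_apply]
    rw [hi, inv_eq_iff_eq]

/-- The elements `z`, `w` and `x` give three-fold transitivity. This allows conjugating `h` to fix,
and one cycle of `g` to be, the three fixed points of `x`; the second cycle of `g` then supplies the
three points moved inside the nine-cycle. -/
theorem exists_isThreeCycle_of_degree_twelve (hα : Fintype.card α = 12) (hK : IsPretransitive K α)
    {z w h g : Equiv.Perm α} (hzK : z ∈ K) (hz : z.IsCycle) (hz11 : z.support.card = 11)
    (hwK : w ∈ K) (hw : w.support.card = 10) (hxK : x ∈ K) (hx : x.IsCycle)
    (hx9 : x.support.card = 9) (hhK : h ∈ K) (hh : h.support.card = 8)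
    (hh2 : ∀ y, h y ≠ y → h (h y) ≠ y) (hgK : g ∈ K) (hg : g.support.card = 6) (hg3 : g ^ 3 = 1) :
    ∃ k ∈ K, IsThreeCycle k := by
  have h2 : ∀ a b a' b' : α, a ≠ b → a' ≠ b' → ∃ k ∈ K, k a = a' ∧ k b = b' :=
    fun a b a' b' hab hab' => exists_mem_map_pair_eq hK hzK hz (by omega) hab hab'
  obtain ⟨p₁, p₂, p₃, h12, h13, h23, hP⟩ := Finset.card_eq_three.1
    (show x.supportᶜ.card = 3 by rw [Finset.card_compl]; omega)
  have h3 := fun (a b c : α) hab hac hbc => exists_mem_map_triple_eq h2 hxK hx h12 h13 h23 hP hwK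
    (by rw [Finset.card_compl]; omega) (a := a) (b := b) (c := c) hab hac hbc
  -- conjugate `h` so that it fixes the fixed points of `x`
  obtain ⟨q, T, hqT, hT, hT3⟩ := Finset.card_eq_succ.1
    (show h.supportᶜ.card = 3 + 1 by rw [Finset.card_compl]; omega)
  obtain ⟨a, b, c, hab, hac, hbc, rfl⟩ := Finset.card_eq_three.1 hT3
  simp only [Finset.mem_insert, Finset.mem_singleton, not_or] at hqT
  have hfixh : ∀ y, h y = y ↔ y = q ∨ y = a ∨ y = b ∨ y = c := fun y => by
    rw [← notMem_support, ← Finset.mem_compl, ← hT]; simp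
  obtain ⟨k, hkK, hka, hkb, hkc⟩ := h3 a b c hab hac hbc
  set h' := k * h * k⁻¹ with hh'
  have hh'K : h' ∈ K := K.mul_mem (K.mul_mem hkK hhK) (K.inv_mem hkK)
  have hh'k : ∀ y, h' (k y) = k (h y) := fun y => by simp [hh']
  have hkq : k q ∈ x.support := by
    by_contra hc
    rw [← Finset.mem_compl, hP, ← hka, ← hkb, ← hkc] at hc
    simp only [Finset.mem_insert, Finset.mem_singleton, k.injective.eq_iff] at hc
    tauto
  have hh'mov : ∀ y ∈ x.support, y ≠ k q → h' (h' y) ≠ y := by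
    intro y hy hyq
    obtain ⟨v, rfl⟩ := k.surjective y
    rw [hh'k, hh'k, k.injective.ne_iff]
    refine hh2 v fun hv => ?_
    rcases (hfixh v).1 hv with rfl | hv
    · exact hyq rfl
    · suffices k v ∈ x.supportᶜ from Finset.mem_compl.1 this hy
      rw [hP, ← hka, ← hkb, ← hkc]
      simpa [k.injective.eq_iff] using hv
  have hh'P : ∀ y ∈ x.supportᶜ, h' y = y := by
    intro y hy
    rw [hP, ← hka, ← hkb, ← hkc] at hy
    simp only [Finset.mem_insert, Finset.mem_singleton] at hy
    rcases hy with rfl | rfl | rfl <;> rw [hh'k, (hfixh _).2 (by simp)]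
  have hh'q : h' (k q) = k q := by rw [hh'k, (hfixh _).2 (by simp)]
  -- conjugate `g` so that it permutes the fixed points of `x` cyclically
  have hg3' : ∀ y, g (g (g y)) = y := fun y => by
    have := congrArg (fun f : Equiv.Perm α => f y) hg3
    simpa [pow_succ] using this
  obtain ⟨u, hu⟩ : ∃ u, g u ≠ u := by
    have : g.support.Nonempty := Finset.card_pos.1 (by omega)
    exact ⟨_, mem_support.1 this.choose_spec⟩
  obtain ⟨l, hlK, hl1, hl2, hl3⟩ := h3 u (g u) (g (g u)) hu.symm
    (fun h => hu (by conv_lhs => rw [h]; exact hg3' u)) fun h => hu (g.injective h.symm)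
  set g' := l * g * l⁻¹ with hg'
  have hg'K : g' ∈ K := K.mul_mem (K.mul_mem hlK hgK) (K.inv_mem hlK)
  have hg'l : ∀ y, g' (l y) = l (g y) := fun y => by simp [hg']
  have hg'6 : g'.support.card = 6 := by rw [hg', card_support_conj, hg]
  have hg'1 : g' p₁ = p₂ := by rw [← hl1, hg'l, hl2]
  have hg'2 : g' p₂ = p₃ := by rw [← hl2, hg'l, hl3]
  have hg'3 : g' p₃ = p₁ := by rw [← hl3, hg'l, hg3', hl1]
  have hg'P : ∀ y, g' y ∈ x.supportᶜ ↔ y ∈ x.supportᶜ := by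
    intro y
    rw [hP]
    simp only [Finset.mem_insert, Finset.mem_singleton]
    constructor
    · rintro (h | h | h)
      · rw [← hg'3] at h; exact Or.inr (Or.inr (g'.injective h))
      · rw [← hg'1] at h; exact Or.inl (g'.injective h)
      · rw [← hg'2] at h; exact Or.inr (Or.inl (g'.injective h))
    · rintro (rfl | rfl | rfl) <;> simp [hg'1, hg'2, hg'3]
  have hsub : x.supportᶜ ⊆ g'.support := by
    intro y hy
    rw [hP] at hy
    simp only [Finset.mem_insert, Finset.mem_singleton] at hy
    rw [mem_support]
    rcases hy with rfl | rfl | rfl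
    · rw [hg'1]; exact h12.symm
    · rw [hg'2]; exact h23.symm
    · rw [hg'3]; exact h13
  have hxc : x.supportᶜ.card = 3 := by rw [Finset.card_compl]; omega
  have hsd : (g'.support \ x.supportᶜ).card = 3 := by
    rw [Finset.card_sdiff_of_subset hsub]; omega
  -- conjugate by a power of `x` so that the point fixed by `h'` is moved
  obtain ⟨d, hd⟩ : (g'.support \ x.supportᶜ).Nonempty := Finset.card_pos.1 (by omega)
  rw [Finset.mem_sdiff, Finset.mem_compl, not_not] at hd
  obtain ⟨i, hi⟩ := hx.exists_pow_eq (mem_support.1 hd.2) (mem_support.1 hkq)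
  set X := x ^ i with hX
  have hXP : ∀ y, X y ∈ x.supportᶜ ↔ y ∈ x.supportᶜ := pow_mem_support_compl_iff i
  have hXP' : ∀ y, X⁻¹ y ∈ x.supportᶜ ↔ y ∈ x.supportᶜ := fun y => by rw [← hXP (X⁻¹ y)]; simp
  have hXfix : ∀ y ∈ x.supportᶜ, X⁻¹ y = y := fun y hy => by
    rw [inv_eq_iff_eq, hX,
      pow_apply_eq_self_of_apply_eq_self (notMem_support.1 (Finset.mem_compl.1 hy))]
  refine exists_isThreeCycle_of_nine_cycle hxK hx hx9 (q := k q) (mem_support.1 hkq)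
    (g := X * g' * X⁻¹) (h := h')
    (K.mul_mem (K.mul_mem (K.pow_mem hxK i) hg'K) (K.inv_mem (K.pow_mem hxK i)))
    (fun y => by simp only [mul_apply]; rw [hXP, hg'P, hXP']) ?_ ?_ hh'K hh'P hh'q hh'mov
  · rw [Finset.card_sdiff_of_subset, card_support_conj]
    · omega
    · intro y hy
      rw [mem_support]
      intro h
      simp only [mul_apply] at h
      rw [hXfix y hy] at h
      have h5 := (hg'P y).2 hy
      rw [← hXfix _ h5] at h
      exact mem_support.1 (hsub hy) (by simpa using h)
  · rw [← hi]
    simp only [mul_apply]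
    intro h
    apply mem_support.1 hd.1
    simpa using h

theorem degree_twelve_contradiction {K : Subgroup (Equiv.Perm (Fin 12))}
    (hK : AvoidsPrimeCycle 12 (HasType K)) (h11 : HasType K {1, 11}) (h66 : HasType K {6, 6})
    (h10 : HasType K {10, 2}) (h9 : HasType K {9, 1, 1, 1}) (h8 : HasType K {8, 2, 1, 1})
    (h6 : HasType K {6, 2, 2, 2}) : False := by
  have htr := isPretransitive_of_hasType_pair h11 h66 (by simp) (by norm_num) (by norm_num)
  rw [Multiset.pair_comm] at h11
  obtain ⟨z, hzK, hz, hz11⟩ := exists_isCycle_mem_of_hasType (q := 11) (s := {1}) (by norm_num)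
    (by simp) h11
  obtain ⟨x, hxK, hx, hx9⟩ := exists_isCycle_mem_of_hasType (q := 9) (s := {1, 1, 1}) (by norm_num)
    (by simp) h9
  obtain ⟨w, hw, hw10, hwK⟩ := exists_pow_isCycle_mem (q := 10) (s := {2}) (by norm_num) h10 2
    (by simp)
  obtain ⟨h, hh, hh8, hhK⟩ := exists_pow_isCycle_mem (q := 8) (s := {2, 1, 1}) (by norm_num) h8 2
    (by simp)
  obtain ⟨g, hg, hg6, hgK⟩ := exists_pow_isCycle_mem (q := 6) (s := {2, 2, 2}) (by norm_num) h6 2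
    (by simp)
  have hwo : orderOf w = 10 := by rw [hw.orderOf, hw10]
  have hho : orderOf h = 8 := by rw [hh.orderOf, hh8]
  have hgo : orderOf g = 6 := by rw [hg.orderOf, hg6]
  obtain ⟨k, hkK, hk⟩ := exists_isThreeCycle_of_degree_twelve (by simp) htr hzK hz hz11 hwK
    (by rw [hw.support_pow_of_pos_of_lt_orderOf (by norm_num) (by rw [hwo]; norm_num), hw10])
    hxK hx hx9 hhK
    (by rw [hh.support_pow_of_pos_of_lt_orderOf (by norm_num) (by rw [hho]; norm_num), hh8])
    -- The square of an eight-cycle consists of two four-cycles, so its own square still moves the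
    -- same points.
    (fun y hy => by
      have h4 : y ∈ (h ^ 4).support := by
        rw [hh.support_pow_of_pos_of_lt_orderOf (by norm_num) (by rw [hho]; norm_num)]
        exact support_pow_le h 2 (mem_support.2 hy)
      rw [mem_support, show h ^ 4 = h ^ 2 * h ^ 2 by rw [← pow_add]] at h4
      exact h4)
    hgK (by rw [hg.support_pow_of_pos_of_lt_orderOf (by norm_num) (by rw [hgo]; norm_num), hg6])
    (by rw [← pow_mul, show 2 * 3 = orderOf g by rw [hgo], pow_orderOf_eq_one])
  exact not_isThreeCycle_of_avoidsPrimeCycle (by simp) (by simpa using hK) hkK hk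

end DegreeTwelve
-- Degree 9: the two classes of nine-cycles
section DegreeNine

open scoped Fin.NatCast Fin.CommRing

/-- A finite check over all affine maps modulo 9 for which the orbit of 0 is everything. The product
counts the inversions of the enumeration of this orbit, so it is the sign of that enumeration. -/
theorem sign_affine_orbit : ∀ j b : Fin 9,
    Function.Injective (fun n : Fin 9 => (fun t => b + j * t)^[n.val] 0) →
    (∏ m : Fin 9, ∏ n ∈ Finset.Iio m, if (fun t => b + j * t)^[n.val] 0 <
      ((fun t => b + j * t)^[m.val] 0 : Fin 9) then 1 else -1) = (1 : ℤˣ) := by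
  decide

theorem sign_eq_one_of_affine (c : Equiv.Perm (Fin 9)) (b j : Fin 9) (h0 : c 0 = 0)
    (hc : ∀ t, c (t + 1) = b + j * c t) : sign c = 1 := by
  have hiter : ∀ n : ℕ, c (n : Fin 9) = (fun t => b + j * t)^[n] 0 := by
    intro n
    induction n with
    | zero => simpa using h0
    | succ n ih => rw [Function.iterate_succ_apply', ← ih, Nat.cast_succ, hc]
  have hval : ∀ n : Fin 9, c n = (fun t => b + j * t)^[n.val] 0 := fun n => by
    rw [← hiter n.val, Fin.cast_val_eq_self]
  rw [sign_eq_prod_prod_Iio]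
  simp only [hval]
  refine sign_affine_orbit j b ?_
  have : (fun n : Fin 9 => (fun t => b + j * t)^[n.val] 0) = c := funext fun n => (hval n).symm
  rw [this]
  exact c.injective

theorem apply_eq_add_mul {f : Fin 9 → Fin 9} {j : Fin 9} (hf : ∀ t, f (t + 1) = f t + j) (t : Fin 9) :
    f t = f 0 + j * t := by
  have : ∀ n : ℕ, f (n : Fin 9) = f 0 + j * n := by
    intro n
    induction n with
    | zero => simp
    | succ n ih => rw [Nat.cast_succ, hf, ih]; ring
  simpa using this t.val

/-- A nine-cycle that normalizes another one is conjugate to it only by even permutations. -/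
theorem sign_eq_one_of_conj_finRotate {c : Equiv.Perm (Fin 9)}
    (h : (c * finRotate 9 * c⁻¹) * finRotate 9 * (c * finRotate 9 * c⁻¹)⁻¹ ∈
      Subgroup.zpowers (finRotate 9)) : sign c = 1 := by
  obtain ⟨i, hi⟩ := Subgroup.mem_zpowers_iff.1 h
  have hzpow : ∀ (k : ℤ) (t : Fin 9), (finRotate 9 ^ k) t = (finRotate 9 ^ k) 0 + t := by
    intro k t
    have := apply_eq_add_mul (f := (finRotate 9 ^ k : Equiv.Perm (Fin 9))) (j := 1) (fun t => by
      rw [← finRotate_apply, ← finRotate_apply ((finRotate 9 ^ k) t), ← mul_apply, ← mul_apply,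
        (Commute.refl (finRotate 9)).zpow_left k |>.eq]) t
    rwa [one_mul] at this
  -- Composing `c` with a power of the rotation changes neither the conjugate `y` nor the sign, and
  -- normalizes the conjugator to fix 0. As `y` normalizes the rotation group it is affine, so `d`
  -- enumerates an affine orbit.
  obtain ⟨m, hm⟩ := (isCycle_finRotate_of_le (n := 9) (by norm_num)).exists_zpow_eq
    (x := 0) (y := c⁻¹ 0) (by decide) (by rw [finRotate_apply]; simp)
  set y := c * finRotate 9 * c⁻¹ with hy
  set d := c * finRotate 9 ^ m with hd
  have hyd : ∀ t, d (t + 1) = y (d t) := by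
    intro t
    rw [hy, hd, ← finRotate_apply]
    simp only [← mul_apply]
    congr 1
    rw [mul_assoc c, ← zpow_add_one, mul_assoc _ c⁻¹, inv_mul_cancel_left, mul_assoc, ← zpow_one_add,
      add_comm]
  have hyt : ∀ t, y (t + 1) = y t + (finRotate 9 ^ i) 0 := by
    intro t
    have : y * finRotate 9 = finRotate 9 ^ i * y := by rw [hi]; group
    rw [← finRotate_apply, ← mul_apply, this, mul_apply, hzpow i (y t), add_comm]
  have hsign : sign d = 1 := by
    refine sign_eq_one_of_affine d (y 0) ((finRotate 9 ^ i) 0) ?_ fun t => ?_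
    · rw [hd, mul_apply, hm]; simp
    · rw [hyd, apply_eq_add_mul hyt]
  rwa [hd, Equiv.Perm.sign_mul, map_zpow, sign_finRotate, show (-1 : ℤˣ) ^ (9 - 1) = 1 by decide, one_zpow,
    mul_one] at hsign

/-- The 3-part of 9! is 3⁴. A group `P` of that order would be a Sylow subgroup and so contain
three-cycles; hence the cyclic group of order 9 has index 1 or 3 in `P` and is normal. -/
theorem conj_mem_zpowers_of_isPGroup {P : Subgroup (Equiv.Perm (Fin 9))} (hP : IsPGroup 3 P)
    (h3 : ∀ k ∈ P, ¬ IsThreeCycle k) {x y : Equiv.Perm (Fin 9)} (hx : x ∈ P) (hxo : orderOf x = 9)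
    (hy : y ∈ P) : y * x * y⁻¹ ∈ Subgroup.zpowers x := by
  have : Fact (Nat.Prime 3) := ⟨Nat.prime_three⟩
  obtain ⟨k, hk⟩ := IsPGroup.iff_card.1 hP
  have hperm : Nat.card (Equiv.Perm (Fin 9)) = 3 ^ 4 * 4480 := by
    rw [Nat.card_perm, Nat.card_fin]; rfl
  have hfac : (Nat.card (Equiv.Perm (Fin 9))).factorization 3 = 4 := by
    rw [hperm, Nat.factorization_mul (by norm_num) (by norm_num),
      Nat.factorization_pow]
    simp [Nat.prime_three.factorization, Nat.factorization_eq_zero_of_not_dvd]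
  have hk4 : k ≤ 4 := by
    rw [← hfac, ← Nat.prime_three.pow_dvd_iff_le_factorization Nat.card_pos.ne', ← hk]
    exact Subgroup.card_subgroup_dvd_card P
  have hk3 : k ≠ 4 := by
    rintro rfl
    let Q : Sylow 3 (Equiv.Perm (Fin 9)) := Sylow.ofCard P (by rw [hk, hfac])
    have ht : IsThreeCycle (Equiv.swap (0 : Fin 9) 1 * Equiv.swap 0 2) :=
      isThreeCycle_swap_mul_swap_same (by decide) (by decide) (by decide)
    set t := Equiv.swap (0 : Fin 9) 1 * Equiv.swap 0 2
    obtain ⟨R, hR⟩ := IsPGroup.exists_le_sylow (p := 3) (P := Subgroup.zpowers t)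
      (IsPGroup.of_card (n := 1) (by rw [Nat.card_zpowers, ht.orderOf, pow_one]))
    obtain ⟨g, hg⟩ := MulAction.exists_smul_eq (Equiv.Perm (Fin 9)) R Q
    have h1 : g * t * g⁻¹ ∈ (g • R : Sylow 3 _) := by
      rw [Sylow.smul_def]
      simpa using! Subgroup.smul_mem_pointwise_smul t (MulAut.conj g) R.1
        (hR (Subgroup.mem_zpowers t))
    rw [hg] at h1
    refine h3 _ h1 ?_
    rw [IsThreeCycle, cycleType_conj]
    exact ht
  set N := (Subgroup.zpowers x).subgroupOf P with hN
  have hle : Subgroup.zpowers x ≤ P := by rwa [Subgroup.zpowers_le]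
  have hNcard : Nat.card N = 3 ^ 2 := by
    rw [hN, Nat.card_congr (Subgroup.subgroupOfEquivOfLe hle).toEquiv, Nat.card_zpowers, hxo]
    norm_num
  have hidx := N.card_mul_index
  rw [hNcard, hk] at hidx
  have hk2 : 2 ≤ k := (Nat.pow_dvd_pow_iff_le_right (by norm_num : 1 < 3)).1 (Dvd.intro _ hidx)
  have hnormal : N.Normal := by
    obtain rfl | rfl : k = 2 ∨ k = 3 := by omega
    · have : N = ⊤ := Subgroup.index_eq_one.1 (by omega)
      rw [this]
      infer_instance
    · apply Subgroup.normal_of_index_eq_minFac_card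
      rw [hk, Nat.Prime.pow_minFac Nat.prime_three (by norm_num)]
      omega
  exact hnormal.conj_mem ⟨x, hx⟩ (Subgroup.mem_zpowers x) ⟨y, hy⟩

/-- A subgroup of the alternating group of degree nine without three-cycles does not meet both
classes of nine-cycles. -/
theorem degree_nine_contradiction {H : Subgroup (Equiv.Perm (Fin 9))}
    (hH : H ≤ alternatingGroup (Fin 9)) (h3 : ∀ k ∈ H, ¬ IsThreeCycle k)
    (hcov : ∀ σ : Equiv.Perm (Fin 9), σ.cycleType = {9} →
      ∃ g ∈ alternatingGroup (Fin 9), g * σ * g⁻¹ ∈ H) : False := by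
  have : Fact (Nat.Prime 3) := ⟨Nat.prime_three⟩
  have hct : (finRotate 9).cycleType = {9} := cycleType_finRotate_of_le (by norm_num)
  have hord : orderOf (finRotate 9) = 9 := by rw [← lcm_cycleType, hct]; rfl
  obtain ⟨g₁, hg₁, hx⟩ := hcov (finRotate 9) hct
  obtain ⟨g₂, hg₂, hy⟩ := hcov (Equiv.swap 0 1 * finRotate 9 * (Equiv.swap 0 1)⁻¹)
    (by rw [cycleType_conj, hct])
  let H₁ := H.comap (MulAut.conj g₁).toMonoidHom
  have hmem : ∀ t, t ∈ H₁ ↔ g₁ * t * g₁⁻¹ ∈ H := fun t => Iff.rfl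
  -- The conjugator `c` is odd: it joins nine-cycles from the two different classes, both present in
  -- `H₁`.
  set c := g₁⁻¹ * g₂ * Equiv.swap 0 1 with hc
  have hxH : finRotate 9 ∈ H₁ := hx
  have hyH : c * finRotate 9 * c⁻¹ ∈ H₁ := by
    rw [hmem]
    convert hy using 1
    rw [hc]
    group
  have hpg : ∀ z : H₁, orderOf z = 9 → IsPGroup 3 (Subgroup.zpowers z) := fun z hz =>
    IsPGroup.of_card (n := 2) (by rw [Nat.card_zpowers, hz]; norm_num)
  obtain ⟨Q, hQ⟩ := (hpg ⟨_, hxH⟩ (by rw [Subgroup.orderOf_mk, hord])).exists_le_sylow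
  obtain ⟨R, hR⟩ := (hpg ⟨_, hyH⟩ (by
    rw [Subgroup.orderOf_mk, ← MulAut.conj_apply]
    exact ((MulAut.conj c).orderOf_eq _).trans hord)).exists_le_sylow
  -- Conjugating by the even permutation `h` places both nine-cycles in one Sylow 3-subgroup and
  -- keeps the conjugator odd, while normality there will force it to be even.
  obtain ⟨h, hh⟩ := MulAction.exists_smul_eq H₁ R Q
  have hyQ : h * ⟨_, hyH⟩ * h⁻¹ ∈ (Q : Subgroup H₁) := by
    have h1 : h * ⟨_, hyH⟩ * h⁻¹ ∈ (h • R : Sylow 3 H₁) := by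
      rw [Sylow.smul_def]
      simpa using! Subgroup.smul_mem_pointwise_smul _ (MulAut.conj h) R.1
        (hR (Subgroup.mem_zpowers (⟨_, hyH⟩ : H₁)))
    rwa [hh] at h1
  have hsign : ∀ t ∈ H₁, sign t = 1 := fun t ht => by
    have := mem_alternatingGroup.1 (hH ((hmem t).1 ht))
    rwa [Equiv.Perm.sign_mul, Equiv.Perm.sign_mul, sign_inv, mul_right_comm, Int.units_mul_self, one_mul] at this
  have key := conj_mem_zpowers_of_isPGroup (P := Q.1.map H₁.subtype) (Q.isPGroup'.map _)
    (by
      rintro _ ⟨k, -, rfl⟩ hk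
      refine h3 _ ((hmem k).1 k.2) ?_
      rw [IsThreeCycle, cycleType_conj]
      exact hk)
    ⟨⟨_, hxH⟩, hQ (Subgroup.mem_zpowers _), rfl⟩ hord ⟨_, hyQ, rfl⟩
  have key' : (h * (c * finRotate 9 * c⁻¹) * (h : Equiv.Perm (Fin 9))⁻¹) * finRotate 9 *
      (h * (c * finRotate 9 * c⁻¹) * (h : Equiv.Perm (Fin 9))⁻¹)⁻¹ ∈
      Subgroup.zpowers (finRotate 9) := key
  rw [show h * (c * finRotate 9 * c⁻¹) * (h : Equiv.Perm (Fin 9))⁻¹ =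
    h * c * finRotate 9 * (h * c)⁻¹ by group] at key'
  have hfin := sign_eq_one_of_conj_finRotate key'
  rw [hc, Equiv.Perm.sign_mul, hsign h h.2, Equiv.Perm.sign_mul, Equiv.Perm.sign_mul, sign_inv, mem_alternatingGroup.1 hg₁,
    mem_alternatingGroup.1 hg₂, sign_swap (by decide)] at hfin
  exact absurd hfin (by decide)

end DegreeNine
-- Coverings by conjugates in finite groups
section Coverings

variable {G : Type*} [Group G] [Finite G]

/-- The conjugates of a proper subgroup of a finite group do not cover the group (Jordan). -/
theorem exists_forall_conj_notMem {H : Subgroup G} (hH : H ≠ ⊤) : ∃ σ : G, ∀ g : G, g * σ * g⁻¹ ∉ H := by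
  classical
  have := Fintype.ofFinite G
  by_contra! h
  -- Burnside's lemma: on the transitive set of cosets the average number of fixed points is 1. If
  -- every element had a fixed point, the average would exceed 1, since the identity fixes at least
  -- two cosets.
  have hsum := MulAction.sum_card_fixedBy_eq_card_orbits_mul_card_group G (G ⧸ H)
  have horb : Fintype.card (Quotient (MulAction.orbitRel G (G ⧸ H))) = 1 := by
    rw [Fintype.card_eq_one_iff_nonempty_unique]
    have := MulAction.isPretransitive_quotient G H
    exact ⟨⟨⟨Quotient.mk'' (QuotientGroup.mk 1)⟩, fun a => by
      induction a using Quotient.inductionOn' with | _ a => ?_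
      exact Quotient.sound' (MulAction.exists_smul_eq G _ a)⟩⟩
  rw [horb, one_mul, ← Finset.card_univ, Finset.card_eq_sum_ones] at hsum
  refine absurd hsum (ne_of_gt (Finset.sum_lt_sum (fun σ _ => ?_) ⟨1, Finset.mem_univ _, ?_⟩))
  · obtain ⟨g, hg⟩ := h σ
    refine Fintype.card_pos_iff.2 ⟨⟨QuotientGroup.mk g⁻¹, ?_⟩⟩
    rw [MulAction.mem_fixedBy, MulAction.Quotient.smul_mk, smul_eq_mul, eq_comm, QuotientGroup.eq]
    simpa [mul_assoc] using hg
  · rw [Fintype.one_lt_card_iff]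
    obtain ⟨x, hx⟩ : ∃ x, x ∉ H := by
      by_contra! hall
      exact hH ((Subgroup.eq_top_iff' H).2 hall)
    refine ⟨⟨QuotientGroup.mk 1, by simp⟩, ⟨QuotientGroup.mk x, by simp⟩, fun heq => hx ?_⟩
    have := QuotientGroup.eq.1 (congrArg Subtype.val heq)
    simpa using this

theorem mem_map_conj_iff {G : Type*} [Group G] {H : Subgroup G} {g σ : G} :
    σ ∈ H.map (MulAut.conj g).toMonoidHom ↔ g⁻¹ * σ * g ∈ H := by
  constructor
  · rintro ⟨h, hh, rfl⟩
    simpa [mul_assoc] using hh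
  · intro h
    exact ⟨_, h, by simp [mul_assoc]⟩

/-- An inclusion would make the conjugates of `K` alone cover the group, against Jordan's result.
This is why the condition on inclusions is automatic. -/
theorem not_map_conj_le {H K : Subgroup G} (hK : K ≠ ⊤)
    (hcov : ∀ σ : G, (∃ g, g * σ * g⁻¹ ∈ H) ∨ ∃ g, g * σ * g⁻¹ ∈ K) (a b : G) :
    ¬ H.map (MulAut.conj a).toMonoidHom ≤ K.map (MulAut.conj b).toMonoidHom := by
  intro hle
  obtain ⟨σ, hσ⟩ := exists_forall_conj_notMem hK
  rcases hcov σ with ⟨g, hg⟩ | ⟨g, hg⟩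
  · have h1 : a * (g * σ * g⁻¹) * a⁻¹ ∈ H.map (MulAut.conj a).toMonoidHom :=
      mem_map_conj_iff.2 (by simpa [mul_assoc] using hg)
    have h2 := mem_map_conj_iff.1 (hle h1)
    refine hσ (b⁻¹ * a * g) ?_
    simpa [mul_assoc] using h2
  · exact hσ g hg

theorem eq_of_map_conj_le {H : Subgroup G} {a b : G}
    (hle : H.map (MulAut.conj a).toMonoidHom ≤ H.map (MulAut.conj b).toMonoidHom) :
    H.map (MulAut.conj a).toMonoidHom = H.map (MulAut.conj b).toMonoidHom := by
  apply Subgroup.eq_of_le_of_card_ge hle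
  rw [Subgroup.card_map_of_injective (MulAut.conj b).injective,
    Subgroup.card_map_of_injective (MulAut.conj a).injective]

theorem isStarStarCoverable_of_forall {H K : Subgroup G} (hH : H ≠ ⊤) (hK : K ≠ ⊤)
    (hcov : ∀ σ : G, (∃ g, g * σ * g⁻¹ ∈ H) ∨ ∃ g, g * σ * g⁻¹ ∈ K) : IsStarStarCoverable G := by
  refine ⟨H, K, hH, hK, ?_, ?_, ?_⟩
  · have hmap : ∀ (L : Subgroup G) (g : G), L ≠ ⊤ → L.map (MulAut.conj g).toMonoidHom ≠ ⊤ := by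
      intro L g hL h
      refine hL ((Subgroup.eq_top_iff' L).2 fun x => ?_)
      have : g * x * g⁻¹ ∈ L.map (MulAut.conj g).toMonoidHom := by rw [h]; trivial
      simpa [mul_assoc] using mem_map_conj_iff.1 this
    rintro L (⟨g, rfl⟩ | ⟨g, rfl⟩)
    · exact hmap H g hH
    · exact hmap K g hK
  · rw [Set.eq_univ_iff_forall]
    intro σ
    simp only [Set.mem_iUnion]
    rcases hcov σ with ⟨g, hg⟩ | ⟨g, hg⟩
    · exact ⟨_, Or.inl ⟨g⁻¹, rfl⟩, mem_map_conj_iff.2 (by simpa using hg)⟩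
    · exact ⟨_, Or.inr ⟨g⁻¹, rfl⟩, mem_map_conj_iff.2 (by simpa using hg)⟩
  · rintro L (⟨a, rfl⟩ | ⟨a, rfl⟩) M (⟨b, rfl⟩ | ⟨b, rfl⟩) hne hle
    · exact hne (eq_of_map_conj_le hle)
    · exact not_map_conj_le hK hcov a b hle
    · exact not_map_conj_le hH (fun σ => (hcov σ).symm) a b hle
    · exact hne (eq_of_map_conj_le hle)

end Coverings

/-! ### Reduction of small degrees to a finite check -/

section SmallDegrees

/-- The multisets of at most `f` integers `≥ 2` with sum at most `r`, with repetitions. -/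
def boundedTypes : ℕ → ℕ → List (Multiset ℕ)
  | 0, _ => [0]
  | f + 1, r => 0 :: (List.range' 2 (r - 1)).flatMap fun a => (boundedTypes f (r - a)).map (a ::ₘ ·)

theorem mem_boundedTypes {f r : ℕ} {m : Multiset ℕ} (hm : ∀ x ∈ m, 2 ≤ x) (hr : m.sum ≤ r)
    (hf : m.card ≤ f) : m ∈ boundedTypes f r := by
  induction f generalizing r m with
  | zero => simp [boundedTypes, Multiset.card_eq_zero.1 (Nat.le_zero.1 hf)]
  | succ f ih =>
    induction m using Multiset.induction with
    | empty => simp [boundedTypes]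
    | cons a t _ =>
      rw [Multiset.sum_cons] at hr
      rw [Multiset.card_cons] at hf
      have ha := hm a (Multiset.mem_cons_self _ _)
      rw [boundedTypes, List.mem_cons, List.mem_flatMap]
      refine Or.inr ⟨a, ?_, List.mem_map.2 ⟨t, ?_, rfl⟩⟩
      · rw [List.mem_range'_1]; omega
      · exact ih (fun x hx => hm x (Multiset.mem_cons_of_mem hx)) (by omega) (by omega)

theorem cycleType_mem_boundedTypes {n f : ℕ} (hf : n < 2 * f + 2) (σ : Equiv.Perm (Fin n)) :
    σ.cycleType ∈ boundedTypes f n := by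
  have h2 : ∀ x ∈ σ.cycleType, 2 ≤ x := fun x hx => two_le_of_mem_cycleType hx
  have hs : σ.cycleType.sum ≤ n := by simpa using sum_cycleType_le σ
  refine mem_boundedTypes h2 hs ?_
  have := Multiset.card_nsmul_le_sum h2
  rw [smul_eq_mul] at this
  omega

variable {α : Type*}

/-- The automorphism group of a ternary operation. -/
def ternaryStabilizer (m : α → α → α → α) : Subgroup (Equiv.Perm α) where
  carrier := {σ | ∀ a b c, σ (m a b c) = m (σ a) (σ b) (σ c)}
  mul_mem' {σ τ} hσ hτ a b c := by rw [mul_apply, hτ, hσ]; rfl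
  one_mem' _ _ _ := rfl
  inv_mem' {σ} hσ a b c := by rw [inv_eq_iff_eq, hσ]; simp

/-- The permutations that map the set `S` to itself. -/
def setStabilizer (S : Set α) : Subgroup (Equiv.Perm α) where
  carrier := {σ | ∀ a, σ a ∈ S ↔ a ∈ S}
  mul_mem' {σ τ} hσ hτ a := by rw [mul_apply, hσ, hτ]
  one_mem' _ := Iff.rfl
  inv_mem' {σ} hσ a := by rw [← hσ]; simp

instance [Fintype α] [DecidableEq α] (m : α → α → α → α) (σ : Equiv.Perm α) :
    Decidable (σ ∈ ternaryStabilizer m) :=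
  inferInstanceAs (Decidable (∀ a b c, σ (m a b c) = m (σ a) (σ b) (σ c)))

instance [Fintype α] (S : Set α) [DecidablePred (· ∈ S)] (σ : Equiv.Perm α) :
    Decidable (σ ∈ setStabilizer S) :=
  inferInstanceAs (Decidable (∀ a, σ a ∈ S ↔ a ∈ S))

variable [Fintype α] [DecidableEq α]

/-- The subgroup `H` meets every class of even permutations of cycle type `m`. -/
def MeetsClasses (H : Subgroup (Equiv.Perm α)) (m : Multiset ℕ) : Prop :=
  ∃ ρ h : Equiv.Perm α, ρ.cycleType = m ∧ sign h = -1 ∧ ρ ∈ H ∧ h * ρ * h⁻¹ ∈ H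

/-- Permutations of a given cycle type are conjugate to `ρ`. If the conjugator is odd, composing it
with the odd `h` makes it even and still leads into `H`; so possible splitting of the class does no
harm. -/
theorem MeetsClasses.exists_conj_mem {H : Subgroup (Equiv.Perm α)} {σ : Equiv.Perm α}
    (hH : MeetsClasses H σ.cycleType) : ∃ g ∈ alternatingGroup α, g * σ * g⁻¹ ∈ H := by
  obtain ⟨ρ, h, hρ, hh, h1, h2⟩ := hH
  obtain ⟨g, hg⟩ := isConj_iff.1 (isConj_iff_cycleType_eq.2 hρ.symm)
  rcases Int.units_eq_one_or (sign g) with hs | hs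
  · exact ⟨g, hs, by rwa [hg]⟩
  · refine ⟨h * g, by rw [mem_alternatingGroup, Equiv.Perm.sign_mul, hs, hh]; rfl, ?_⟩
    rwa [show h * g * σ * (h * g)⁻¹ = h * (g * σ * g⁻¹) * h⁻¹ by group, hg]

/-- Nontrivial cycles have length at least 2, so the bound on `f` makes `boundedTypes` list every
cycle type of degree `n`. -/
theorem isStarStarCoverable_alternatingGroup {n f : ℕ} (hf : n < 2 * f + 2)
    {H K : Subgroup (Equiv.Perm (Fin n))} (hH : ∃ σ, sign σ = 1 ∧ σ ∉ H)
    (hK : ∃ σ, sign σ = 1 ∧ σ ∉ K)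
    (hcov : ∀ m ∈ boundedTypes f n, Even (m.sum + m.card) → MeetsClasses H m ∨ MeetsClasses K m) :
    IsStarStarCoverable (alternatingGroup (Fin n)) := by
  have hne : ∀ L : Subgroup (Equiv.Perm (Fin n)), (∃ σ, sign σ = 1 ∧ σ ∉ L) →
      L.subgroupOf (alternatingGroup (Fin n)) ≠ ⊤ := by
    rintro L ⟨σ, hs, hσ⟩ h
    rw [Subgroup.subgroupOf_eq_top] at h
    exact hσ (h hs)
  refine isStarStarCoverable_of_forall (hne H hH) (hne K hK) fun σ => ?_
  have heven : Even (σ.1.cycleType.sum + σ.1.cycleType.card) := by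
    have := mem_alternatingGroup.1 σ.2
    rw [sign_of_cycleType] at this
    by_contra hodd
    rw [Nat.not_even_iff_odd] at hodd
    rw [hodd.neg_one_pow] at this
    exact absurd this (by decide)
  have key : ∀ L : Subgroup (Equiv.Perm (Fin n)), MeetsClasses L σ.1.cycleType →
      ∃ g, g * σ * g⁻¹ ∈ L.subgroupOf (alternatingGroup (Fin n)) := fun L hL => by
    obtain ⟨g, hg, h⟩ := hL.exists_conj_mem
    exact ⟨⟨g, hg⟩, h⟩
  exact (hcov _ (cycleType_mem_boundedTypes hf σ.1) heven).imp (key H) (key K)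

end SmallDegrees

/-! ### The coverings in degrees 4 to 8 -/

section Examples

/-- The harmonic conjugate of `c` with respect to `a` and `b` on the projective line over the field
with five elements, the point at infinity being `5`. -/
def harmonicConjugate (a b c : Fin 6) : Fin 6 :=
  if a = b then c else
    -- In the finite case `i` is the midpoint of `a` and `b`, 3 being the inverse of 2 modulo 5.
    -- Reflection in `i` gives the harmonic conjugate of the other points because 3 is also -2; it
    -- exchanges `a` and `b`, a convention that linear fractional maps respect too.
    let i := if a = 5 then b.val else if b = 5 then a.val else 3 * (a.val + b.val) % 5
    if c = 5 then Fin.ofNat 6 i else if c.val = i then 5 else Fin.ofNat 6 ((2 * i + 5 - c.val) % 5)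

/-- The third point on the line through `a` and `b` in the Fano plane, where the point `a` is the
binary vector with value `a + 1`. -/
def fanoThirdPoint (a b : Fin 7) : Fin 7 :=
  if a = b then a else Fin.ofNat 7 (((a.val + 1) ^^^ (b.val + 1)) - 1)

theorem boundedTypes_four : ∀ m ∈ boundedTypes 2 4, Even (m.sum + m.card) →
    m ∈ ([0, {2, 2}, {3}] : List (Multiset ℕ)) := by decide

theorem boundedTypes_five : ∀ m ∈ boundedTypes 2 5, Even (m.sum + m.card) →
    m ∈ ([0, {2, 2}, {3}, {5}] : List (Multiset ℕ)) := by decide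

theorem boundedTypes_six : ∀ m ∈ boundedTypes 3 6, Even (m.sum + m.card) →
    m ∈ ([0, {2, 2}, {3}, {3, 3}, {4, 2}, {5}] : List (Multiset ℕ)) := by decide

theorem boundedTypes_seven : ∀ m ∈ boundedTypes 3 7, Even (m.sum + m.card) →
    m ∈ ([0, {2, 2}, {3}, {3, 2, 2}, {3, 3}, {4, 2}, {5}, {7}] : List (Multiset ℕ)) := by decide

theorem boundedTypes_eight : ∀ m ∈ boundedTypes 4 8, Even (m.sum + m.card) →
    m ∈ ([0, {2, 2}, {2, 2, 2, 2}, {3}, {3, 2, 2}, {3, 3}, {4, 2}, {4, 4}, {5}, {5, 3}, {6, 2},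
      {7}] : List (Multiset ℕ)) := by decide

/-- The operation ignores two arguments, so `H` is the centralizer of the double transposition (0
1)(2 3), a dihedral group of order 8. -/
theorem isStarStarCoverable_four : IsStarStarCoverable (alternatingGroup (Fin 4)) := by
  refine isStarStarCoverable_alternatingGroup (f := 2) (by norm_num)
    (H := ternaryStabilizer fun a _ _ => a ^^^ 1) (K := setStabilizer {0})
    ⟨c[1, 2, 3], by decide, by decide⟩ ⟨c[0, 1, 2], by decide, by decide⟩ fun m hm he => ?_
  have := boundedTypes_four m hm he
  simp only [List.mem_cons, List.not_mem_nil, or_false] at this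
  rcases this with rfl | rfl | rfl
  · exact Or.inr ⟨1, c[2, 3], by decide, by decide, by decide, by decide⟩
  · exact Or.inl ⟨c[0, 1] * c[2, 3], c[2, 3], by decide, by decide, by decide, by decide⟩
  · exact Or.inr ⟨c[1, 2, 3], c[2, 3], by decide, by decide, by decide, by decide⟩

/-- `H` is the affine group of the line over the field with five elements. It is needed only for the
five-cycles; all other even types fix a point. -/
theorem isStarStarCoverable_five : IsStarStarCoverable (alternatingGroup (Fin 5)) := by
  refine isStarStarCoverable_alternatingGroup (f := 2) (by norm_num)
    (H := ternaryStabilizer (fun a b c => a - b + c)) (K := setStabilizer {0})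
    ⟨c[0, 1, 2], by decide, by decide⟩ ⟨c[0, 1, 2], by decide, by decide⟩ fun m hm he => ?_
  have := boundedTypes_five m hm he
  simp only [List.mem_cons, List.not_mem_nil, or_false] at this
  rcases this with rfl | rfl | rfl | rfl
  · exact Or.inr ⟨1, c[3, 4], by decide, by decide, by decide, by decide⟩
  · exact Or.inr ⟨c[1, 2] * c[3, 4], c[3, 4], by decide, by decide, by decide, by decide⟩
  · exact Or.inr ⟨c[1, 2, 3], c[3, 4], by decide, by decide, by decide, by decide⟩
  · exact Or.inl ⟨c[0, 1, 2, 3, 4], c[1, 2, 4, 3], by decide, by decide, by decide, by decide⟩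

/-- `H` contains PGL(2, 5) acting on the projective line, which supplies the types {3, 3} and {5};
the others preserve a pair of points. -/
theorem isStarStarCoverable_six : IsStarStarCoverable (alternatingGroup (Fin 6)) := by
  refine isStarStarCoverable_alternatingGroup (f := 3) (by norm_num)
    (H := ternaryStabilizer harmonicConjugate) (K := setStabilizer {0, 1})
    ⟨c[0, 1, 2], by decide, by decide⟩ ⟨c[0, 1, 2], by decide, by decide⟩ fun m hm he => ?_
  have := boundedTypes_six m hm he
  simp only [List.mem_cons, List.not_mem_nil, or_false] at this
  rcases this with rfl | rfl | rfl | rfl | rfl | rfl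
  · exact Or.inr ⟨1, c[4, 5], by decide, by decide, by decide, by decide⟩
  · exact Or.inr ⟨c[0, 1] * c[2, 3], c[4, 5], by decide, by decide, by decide, by decide⟩
  · exact Or.inr ⟨c[2, 3, 4], c[4, 5], by decide, by decide, by decide, by decide⟩
  · exact Or.inl ⟨c[0, 1, 2] * c[3, 5, 4], c[2, 3], by decide, by decide, by decide, by decide⟩
  · exact Or.inr ⟨c[0, 1] * c[2, 3, 4, 5], c[4, 5], by decide, by decide, by decide, by decide⟩
  · exact Or.inl ⟨c[0, 1, 2, 3, 4], c[2, 3, 4, 5], by decide, by decide, by decide, by decide⟩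

/-- The collineation group of the Fano plane supplies the types {3, 3} and {7}; the others preserve
a pair of points. -/
theorem isStarStarCoverable_seven : IsStarStarCoverable (alternatingGroup (Fin 7)) := by
  refine isStarStarCoverable_alternatingGroup (f := 3) (by norm_num)
    (H := ternaryStabilizer (fun a b _ => fanoThirdPoint a b)) (K := setStabilizer {0, 1})
    ⟨c[0, 1, 2], by decide, by decide⟩ ⟨c[0, 1, 2], by decide, by decide⟩ fun m hm he => ?_
  have := boundedTypes_seven m hm he
  simp only [List.mem_cons, List.not_mem_nil, or_false] at this
  rcases this with rfl | rfl | rfl | rfl | rfl | rfl | rfl | rfl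
  · exact Or.inr ⟨1, c[5, 6], by decide, by decide, by decide, by decide⟩
  · exact Or.inr ⟨c[0, 1] * c[2, 3], c[5, 6], by decide, by decide, by decide, by decide⟩
  · exact Or.inr ⟨c[2, 3, 4], c[5, 6], by decide, by decide, by decide, by decide⟩
  · exact Or.inr ⟨c[0, 1] * c[2, 3, 4] * c[5, 6], c[5, 6], by decide, by decide, by decide, by decide⟩
  · exact Or.inl ⟨c[0, 1, 2] * c[3, 4, 6], c[2, 4], by decide, by decide, by decide, by decide⟩
  · exact Or.inr ⟨c[0, 1] * c[2, 3, 4, 5], c[5, 6], by decide, by decide, by decide, by decide⟩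
  · exact Or.inr ⟨c[2, 3, 4, 5, 6], c[5, 6], by decide, by decide, by decide, by decide⟩
  · exact Or.inl ⟨c[0, 1, 3, 2, 5, 6, 4], c[2, 3, 4, 6], by decide, by decide, by decide, by decide⟩

/-- `H` is the affine group of the three-dimensional space over the field with two elements. It
supplies the types {2, 2, 2, 2}, {4, 4}, {6, 2} and {7}, and the others preserve a set of three
points. -/
theorem isStarStarCoverable_eight : IsStarStarCoverable (alternatingGroup (Fin 8)) := by
  refine isStarStarCoverable_alternatingGroup (f := 4) (by norm_num)
    (H := ternaryStabilizer (fun a b c => a ^^^ b ^^^ c)) (K := setStabilizer {0, 1, 2})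
    ⟨c[0, 1, 2], by decide, by decide⟩ ⟨c[0, 1, 3], by decide, by decide⟩ fun m hm he => ?_
  have := boundedTypes_eight m hm he
  simp only [List.mem_cons, List.not_mem_nil, or_false] at this
  rcases this with rfl | rfl | rfl | rfl | rfl | rfl | rfl | rfl | rfl | rfl | rfl | rfl
  · exact Or.inr ⟨1, c[6, 7], by decide, by decide, by decide, by decide⟩
  · exact Or.inr ⟨c[0, 1] * c[3, 4], c[6, 7], by decide, by decide, by decide, by decide⟩
  · exact Or.inl ⟨c[0, 1] * c[2, 3] * c[4, 6] * c[5, 7], c[6, 7], by decide, by decide, by decide, by decide⟩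
  · exact Or.inr ⟨c[0, 1, 2], c[6, 7], by decide, by decide, by decide, by decide⟩
  · exact Or.inr ⟨c[0, 1, 2] * c[3, 5] * c[4, 7], c[6, 7], by decide, by decide, by decide, by decide⟩
  · exact Or.inr ⟨c[0, 1, 2] * c[3, 4, 5], c[6, 7], by decide, by decide, by decide, by decide⟩
  · exact Or.inr ⟨c[0, 1] * c[3, 4, 7, 6], c[6, 7], by decide, by decide, by decide, by decide⟩
  · exact Or.inl ⟨c[0, 1, 2, 3] * c[4, 5, 6, 7], c[5, 7], by decide, by decide, by decide, by decide⟩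
  · exact Or.inr ⟨c[3, 4, 5, 6, 7], c[6, 7], by decide, by decide, by decide, by decide⟩
  · exact Or.inr ⟨c[0, 1, 2] * c[3, 4, 5, 6, 7], c[6, 7], by decide, by decide, by decide, by decide⟩
  · exact Or.inl ⟨c[0, 1, 5, 2, 3, 7] * c[4, 6], c[5, 7], by decide, by decide, by decide, by decide⟩
  · exact Or.inl ⟨c[0, 2, 1, 4, 5, 3, 7], c[3, 4, 7, 5], by decide, by decide, by decide, by decide⟩

end Examples
-- Exclusion of the other degrees
section LargeDegrees

variable {n : ℕ}

theorem exists_conj_mem_of_isGroupCovering {H K : Subgroup (alternatingGroup (Fin n))}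
    (h : IsGroupCovering (conjugateSubgroups H ∪ conjugateSubgroups K)) {σ : Equiv.Perm (Fin n)}
    (hσ : σ ∈ alternatingGroup (Fin n)) :
    ∃ g ∈ alternatingGroup (Fin n), g * σ * g⁻¹ ∈ H.map (alternatingGroup (Fin n)).subtype ∨
      g * σ * g⁻¹ ∈ K.map (alternatingGroup (Fin n)).subtype := by
  have hmem : (⟨σ, hσ⟩ : alternatingGroup (Fin n)) ∈
      ⋃ L ∈ conjugateSubgroups H ∪ conjugateSubgroups K, (L : Set (alternatingGroup (Fin n))) := by
    rw [h.union_eq]; trivial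
  simp only [Set.mem_iUnion] at hmem
  obtain ⟨L, ⟨g, rfl⟩ | ⟨g, rfl⟩, hL⟩ := hmem
  · exact ⟨g⁻¹, (g⁻¹).2, Or.inl ⟨_, mem_map_conj_iff.1 hL, by simp⟩⟩
  · exact ⟨g⁻¹, (g⁻¹).2, Or.inr ⟨_, mem_map_conj_iff.1 hL, by simp⟩⟩

theorem not_alternatingGroup_le_map {H : Subgroup (alternatingGroup (Fin n))} (hH : H ≠ ⊤) :
    ¬ alternatingGroup (Fin n) ≤ H.map (alternatingGroup (Fin n)).subtype := by
  intro h
  refine hH ((Subgroup.eq_top_iff' H).2 fun σ => ?_)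
  obtain ⟨τ, hτ, he⟩ := h σ.2
  rwa [← Subtype.ext (a1 := τ) (a2 := σ) he]

theorem typeTrichotomy_hasType {H : Subgroup (Equiv.Perm (Fin n))}
    (hH : ¬ alternatingGroup (Fin n) ≤ H) : TypeTrichotomy n (HasType H) := by
  have := intransitive_or_imprimitive_or_primitive H hH
  rw [Fintype.card_fin] at this
  rcases this with h | h | ⟨-, h⟩
  · exact Or.inl h
  · exact Or.inr (Or.inl h)
  · exact Or.inr (Or.inr h)

theorem hasType_of_conj_mem {H : Subgroup (Equiv.Perm (Fin n))} {g σ : Equiv.Perm (Fin n)}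
    (h : g * σ * g⁻¹ ∈ H) : HasType H σ.partition.parts :=
  ⟨_, h, by rw [partition_eq_of_isConj.1 (isConj_iff.2 ⟨g, rfl⟩ : IsConj σ (g * σ * g⁻¹))]⟩

theorem coversEvenTypes_hasType {H K : Subgroup (Equiv.Perm (Fin n))}
    (h : ∀ σ ∈ alternatingGroup (Fin n), ∃ g ∈ alternatingGroup (Fin n),
      g * σ * g⁻¹ ∈ H ∨ g * σ * g⁻¹ ∈ K) : CoversEvenTypes n (HasType H) (HasType K) := by
  intro l hpos hsum heven
  obtain ⟨σ, hσ, rfl⟩ := exists_mem_alternatingGroup_parts_eq (α := Fin n) hpos (by simpa using hsum)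
    (by simpa using heven)
  obtain ⟨g, -, hg | hg⟩ := h σ hσ
  · exact Or.inl (hasType_of_conj_mem hg)
  · exact Or.inr (hasType_of_conj_mem hg)

/-- A nine-cycle has no invariant set of 4 or 5 points, so all nine-cycles fall to `H`. Here
conjugacy in A_9 is essential, cycle types alone being insufficient. -/
theorem degree_nine_not_covered {H K : Subgroup (Equiv.Perm (Fin 9))}
    (hH : H ≤ alternatingGroup (Fin 9)) (hcov : ∀ σ ∈ alternatingGroup (Fin 9),
      ∃ g ∈ alternatingGroup (Fin 9), g * σ * g⁻¹ ∈ H ∨ g * σ * g⁻¹ ∈ K)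
    (hp : AvoidsPrimeCycle 9 (HasType H)) {k : ℕ} (hk : k = 4 ∨ k = 5)
    (hq : HasPartialSum (HasType K) k) : False := by
  refine degree_nine_contradiction hH (fun t ht =>
    not_isThreeCycle_of_avoidsPrimeCycle (by simp) (by simpa using hp) ht) fun σ hσ => ?_
  have hs : σ ∈ alternatingGroup (Fin 9) := by
    rw [mem_alternatingGroup, sign_of_cycleType, hσ]; rfl
  obtain ⟨g, hg, h | h⟩ := hcov σ hs
  · exact ⟨g, hg, h⟩
  · have h9 := hasType_of_conj_mem h
    rw [parts_partition, ← sum_cycleType, hσ] at h9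
    have := le_singleton_sum (a := 9) (hq _ (by simpa using h9))
    omega

theorem degree_ten_not_covered {H K : Subgroup (Equiv.Perm (Fin 10))}
    (hcov : CoversEvenTypes 10 (HasType H) (HasType K)) (hp : AvoidsPrimeCycle 10 (HasType H))
    {k : ℕ} (hk : k = 3 ∨ k = 7) (hq : HasPartialSum (HasType K) k) : False := by
  have h : ∀ a b, 0 < a → 0 < b → a + b = 10 → a ≠ 3 → b ≠ 3 → HasType H {a, b} :=
    fun a b ha hb hab ha3 hb3 => (hcov.pair rfl a b ha hb hab).resolve_right fun h => by
      have := le_pair_sum (hq _ h)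
      omega
  apply degree_ten_contradiction hp <;> apply h <;> norm_num

/-- None of the six types has parts with sum 5 or 7, so none occurs in `K`. -/
theorem degree_twelve_not_covered {H K : Subgroup (Equiv.Perm (Fin 12))}
    (hcov : CoversEvenTypes 12 (HasType H) (HasType K)) (hp : AvoidsPrimeCycle 12 (HasType H))
    {k : ℕ} (hk : k = 5 ∨ k = 7) (hq : HasPartialSum (HasType K) k) : False := by
  have h2 : ∀ a b, 0 < a → 0 < b → a + b = 12 → a ≠ 5 → b ≠ 5 → HasType H {a, b} :=
    fun a b ha hb hab ha3 hb3 => (hcov.pair rfl a b ha hb hab).resolve_right fun h => by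
      have := le_pair_sum (hq _ h)
      omega
  refine degree_twelve_contradiction hp (h2 _ _ ?_ ?_ ?_ ?_ ?_) (h2 _ _ ?_ ?_ ?_ ?_ ?_)
    (h2 _ _ ?_ ?_ ?_ ?_ ?_)
    ((hcov.quadruple rfl 9 1 1 1 ?_ ?_ ?_ ?_ ?_).resolve_right fun h => ?_)
    ((hcov.quadruple rfl 8 2 1 1 ?_ ?_ ?_ ?_ ?_).resolve_right fun h => ?_)
    ((hcov.quadruple rfl 6 2 2 2 ?_ ?_ ?_ ?_ ?_).resolve_right fun h => ?_)
  all_goals first | norm_num; done | skip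
  all_goals
    have := le_quadruple_sum (hq _ h)
    omega

theorem not_isStarStarCoverable_of_nine_le (hn : 9 ≤ n) :
    ¬ IsStarStarCoverable (alternatingGroup (Fin n)) := by
  rintro ⟨H, K, hH, hK, hδ⟩
  set p := H.map (alternatingGroup (Fin n)).subtype with hp
  set q := K.map (alternatingGroup (Fin n)).subtype with hq
  have hcov : ∀ σ ∈ alternatingGroup (Fin n), ∃ g ∈ alternatingGroup (Fin n),
      g * σ * g⁻¹ ∈ p ∨ g * σ * g⁻¹ ∈ q := fun σ hσ => exists_conj_mem_of_isGroupCovering hδ hσ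
  have hcov' : ∀ σ ∈ alternatingGroup (Fin n), ∃ g ∈ alternatingGroup (Fin n),
      g * σ * g⁻¹ ∈ q ∨ g * σ * g⁻¹ ∈ p := fun σ hσ => by
    obtain ⟨g, hg, h⟩ := hcov σ hσ
    exact ⟨g, hg, h.symm⟩
  have hpA : p ≤ alternatingGroup (Fin n) := Subgroup.map_subtype_le H
  have hqA : q ≤ alternatingGroup (Fin n) := Subgroup.map_subtype_le K
  have tp := typeTrichotomy_hasType (not_alternatingGroup_le_map hH)
  have tq := typeTrichotomy_hasType (not_alternatingGroup_le_map hK)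
  rw [← hp] at tp
  rw [← hq] at tq
  clear_value p q
  have hc := coversEvenTypes_hasType hcov
  rcases Nat.mod_two_eq_zero_or_one n with h2 | h2
  -- The type {1, n - 1} occurs in one of the two subgroups; stating the exclusion for arbitrary `r`
  -- and `s` lets either play that role.
  · have key : ∀ r s : Subgroup (Equiv.Perm (Fin n)), TypeTrichotomy n (HasType r) →
        TypeTrichotomy n (HasType s) → CoversEvenTypes n (HasType r) (HasType s) →
        ¬ HasType r {1, n - 1} := by
      intro r s hr hs hrs h1
      obtain ⟨hav, k, hk, ⟨rfl, hk'⟩ | ⟨rfl, hk'⟩⟩ :=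
        even_degree_exception_of_pair h2 (by omega) hr hs hrs h1
      · exact degree_ten_not_covered hrs hav hk' hk
      · exact degree_twelve_not_covered hrs hav hk' hk
    rcases hc.pair h2 1 (n - 1) (by omega) (by omega) (by omega) with h | h
    · exact key p q tp tq hc h
    · exact key q p tq tp hc.symm h
  · obtain ⟨rfl, ⟨hav, k, hk, hs⟩ | ⟨hav, k, hk, hs⟩⟩ := odd_degree_exception h2 hn tp tq hc
    · exact degree_nine_not_covered hpA hcov hav hk hs
    · exact degree_nine_not_covered hqA hcov' hav hk hs

theorem not_isStarStarCoverable_of_card_le_prime {G : Type*} [Group G] [Finite G]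
    (hG : Nat.card G = 1 ∨ (Nat.card G).Prime) : ¬ IsStarStarCoverable G := by
  rintro ⟨H, K, hH, hK, hδ⟩
  have hbot : ∀ L : Subgroup G, L ≠ ⊤ → L = ⊥ := by
    intro L hL
    rcases hG with h1 | hp
    · have := (Nat.card_eq_one_iff_unique.1 h1).1
      exact (hL (Subsingleton.elim _ _)).elim
    · have : Fact (Nat.card G).Prime := ⟨hp⟩
      exact (L.eq_bot_or_eq_top_of_prime_card).resolve_right hL
  have hone : ∀ σ : G, σ = 1 := by
    intro σ
    have hmem : σ ∈ ⋃ L ∈ conjugateSubgroups H ∪ conjugateSubgroups K, (L : Set G) := by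
      rw [hδ.union_eq]; trivial
    simp only [Set.mem_iUnion] at hmem
    obtain ⟨L, hL, hσ⟩ := hmem
    rw [hbot L (hδ.proper L hL)] at hσ
    exact hσ
  refine hH ((Subgroup.eq_top_iff' H).2 fun σ => ?_)
  rw [hone σ]
  exact H.one_mem

theorem not_isStarStarCoverable_of_lt_four (hn : n < 4) :
    ¬ IsStarStarCoverable (alternatingGroup (Fin n)) := by
  apply not_isStarStarCoverable_of_card_le_prime
  interval_cases n
  · exact Or.inl (by rw [Nat.card_eq_fintype_card]; decide)
  · exact Or.inl (by rw [Nat.card_eq_fintype_card]; decide)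
  · exact Or.inl (by rw [Nat.card_eq_fintype_card]; decide)
  · refine Or.inr ?_
    rw [show Nat.card (alternatingGroup (Fin 3)) = 3 by rw [Nat.card_eq_fintype_card]; decide]
    exact Nat.prime_three

end LargeDegrees

theorem theorem3p9 (n : ℕ) :
    IsStarStarCoverable (alternatingGroup (Fin n)) ↔ 4 ≤ n ∧ n ≤ 8 := by
  constructor
  · intro h
    constructor
    · by_contra hn
      exact not_isStarStarCoverable_of_lt_four (by omega) h
    · by_contra hn
      exact not_isStarStarCoverable_of_nine_le (by omega) h
  · rintro ⟨h4, h8⟩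
    interval_cases n
    · exact isStarStarCoverable_four
    · exact isStarStarCoverable_five
    · exact isStarStarCoverable_six
    · exact isStarStarCoverable_seven
    · exact isStarStarCoverable_eight
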